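/- Let $\Lambda$ be the real Banach algebra of supernumbers $z=\sum_I z_I\zeta^I$ ($I$ ranging over the finite increasing multi-indices of countably many anticommuting generators $\zeta^i$, $z_I\in\mathbb{R}$) with $\|z\|=\sum_I|z_I|<\infty$, and let $\Lambda=\Lambda^0\oplus\Lambda^1$ be its decomposition into even and odd elements. Let $M$ be a $G^\infty$ supermanifold of dimension $(m,n)$, i.e. a space with an atlas of charts in $\mathbb{R}^{m|n}=(\Lambda^0)^m\times(\Lambda^1)^n$ whose transition maps are $G^\infty$. For $p\in M$ let $T_pM$ be the left $\Lambda$-module of all sums of an even and an odd graded-$\Lambda$-linear graded derivation, at $p$, from the germs of $\Lambda$-valued $G^\infty$ functions to $\Lambda$. Let $g$ be a super Riemannian metric on $M$: a family of biadditive maps $g_p:T_pM\times T_pM\to\Lambda$ such that $g(X,Y)$ is $G^\infty$ on $U$ for all super vector fields $X,Y$ on an open set $U\subseteq M$, and 1. $g_p(\lambda x+\mu y,z)=\lambda g_p(x,z)+\mu g_p(y,z)$ for $\lambda,\mu\in\Lambda$; 2. $g_p(x,y)=(-1)^{|x||y|}g_p(y,x)$ for pure $x,y$; 3. $g_p$ is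 nondegenerate over $\Lambda$: $g_p(\cdot,z)=0$ if and only if $z=0$, and every left $\Lambda$-linear map $T_pM\to\Lambda$ has the form $g_p(\cdot,z)$ (equivalently, the matrix of $g_p$ in a pure basis of $T_pM$ is invertible); 4. $g$ is even: $|g_p(x,y)|=|x|+|y|$ for pure $x,y$. Then $n$ is even, and every $p\in M$ has an open neighbourhood $U$ with $G^\infty$ super vector fields $\bar e_1,\dots,\bar e_m$ (even) and $\bar f_1,\dots,\bar f_n$ (odd) on $U$ that form a pure basis of the $\Lambda$-module $T_qM$ at every $q\in U$ and relative to which the matrix of $g$ on $U$ is $$\Gamma_g=\begin{pmatrix}\eta&0\\0&\mathcal{J}\end{pmatrix},\qquad \eta=\mathrm{diag}(d_1,\dots,d_m),\qquad \mathcal{J}=\mathrm{diag}(J,\dots,J),\qquad J=\begin{pmatrix}0&1\\-1&0\end{pmatrix},$$ where the $d_i:U\to\Lambda^0$ are $G^\infty$ functions whose values are invertible elements of $\Lambda^0$. -/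

import Mathlib

open scoped Topology ENNReal
open Filter

namespace SuperGeometry

noncomputable section

/-! ## Supernumbers -/

/-- The underlying real Banach space of the algebra of (real) supernumbers: absolutely summable
families `z = ∑ z_I ζ^I` indexed by the finite sets `I = {i₁ < ⋯ < i_k}` of natural numbers, where
`ζ^I = ζ^{i₁} ⋯ ζ^{i_k}`, with the norm `‖z‖ = ∑ |z_I|`. -/
def SuperNumber : Type := lp (fun _ : Finset ℕ => ℝ) 1

namespace SuperNumber

instance : NormedAddCommGroup SuperNumber :=
  inferInstanceAs (NormedAddCommGroup (lp (fun _ : Finset ℕ => ℝ) 1))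

instance : NormedSpace ℝ SuperNumber :=
  inferInstanceAs (NormedSpace ℝ (lp (fun _ : Finset ℕ => ℝ) 1))

instance : CompleteSpace SuperNumber :=
  inferInstanceAs (CompleteSpace (lp (fun _ : Finset ℕ => ℝ) 1))

/-- The coefficient `z_I` of `ζ^I`. -/
def coeff (z : SuperNumber) (I : Finset ℕ) : ℝ :=
  (show lp (fun _ : Finset ℕ => ℝ) 1 from z).1 I

@[ext] theorem ext {a b : SuperNumber} (h : ∀ I, a.coeff I = b.coeff I) : a = b :=
  lp.ext (funext h)

@[simp] theorem coeff_add (a b : SuperNumber) (I : Finset ℕ) :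
    (a + b).coeff I = a.coeff I + b.coeff I := rfl

@[simp] theorem coeff_zero (I : Finset ℕ) : (0 : SuperNumber).coeff I = 0 := rfl

@[simp] theorem coeff_neg (a : SuperNumber) (I : Finset ℕ) : (-a).coeff I = -a.coeff I := rfl

@[simp] theorem coeff_sub (a b : SuperNumber) (I : Finset ℕ) :
    (a - b).coeff I = a.coeff I - b.coeff I := rfl

@[simp] theorem coeff_smul (c : ℝ) (a : SuperNumber) (I : Finset ℕ) :
    (c • a).coeff I = c * a.coeff I := rfl

theorem norm_def (z : SuperNumber) : ‖z‖ = ∑' I, |z.coeff I| := by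
  have h := lp.norm_eq_tsum_rpow (p := 1) (by simp) (show lp (fun _ : Finset ℕ => ℝ) 1 from z)
  simp only [ENNReal.toReal_one, Real.rpow_one, div_one] at h
  exact h

theorem summable_abs (z : SuperNumber) : Summable fun I => |z.coeff I| := by
  have h := (memℓp_gen_iff (p := 1) (by simp)).1
    (lp.memℓp (show lp (fun _ : Finset ℕ => ℝ) 1 from z))
  simp only [ENNReal.toReal_one, Real.rpow_one] at h
  exact h

/-- An absolutely summable family of coefficients as a supernumber. -/
def mk (f : Finset ℕ → ℝ) (hf : Summable fun I => |f I|) : SuperNumber :=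
  (⟨f, (memℓp_gen_iff (p := 1) (by simp)).2 (by simpa using hf)⟩ :
    lp (fun _ : Finset ℕ => ℝ) 1)

@[simp] theorem coeff_mk (f : Finset ℕ → ℝ) (hf : Summable fun I => |f I|) (I : Finset ℕ) :
    (mk f hf).coeff I = f I := rfl

/-- The sign with `ζ^A ζ^B = sgn A B • ζ^(A ∪ B)` for disjoint `A`, `B`: the parity of the number
of transpositions that bring the word `ζ^A ζ^B` into increasing order. -/
def sgn (A B : Finset ℕ) : ℝ := (-1) ^ ((A ×ˢ B).filter fun x => x.2 < x.1).card

theorem abs_sgn (A B : Finset ℕ) : |sgn A B| = 1 := by simp [sgn, abs_pow]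

theorem sgn_union_left {A B : Finset ℕ} (C : Finset ℕ) (h : Disjoint A B) :
    sgn (A ∪ B) C = sgn A C * sgn B C := by
  unfold sgn
  rw [← pow_add, Finset.union_product, Finset.filter_union, Finset.card_union_of_disjoint]
  exact Finset.disjoint_filter_filter (Finset.disjoint_product.2 (Or.inl h))

theorem sgn_union_right (A : Finset ℕ) {B C : Finset ℕ} (h : Disjoint B C) :
    sgn A (B ∪ C) = sgn A B * sgn A C := by
  unfold sgn
  rw [← pow_add, Finset.product_union, Finset.filter_union, Finset.card_union_of_disjoint]
  exact Finset.disjoint_filter_filter (Finset.disjoint_product.2 (Or.inr h))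

theorem sgn_swap {A B : Finset ℕ} (h : Disjoint A B) :
    sgn B A = (-1) ^ (A.card * B.card) * sgn A B := by
  have h1 : ((B ×ˢ A).filter fun x => x.2 < x.1).card
      = ((A ×ˢ B).filter fun x => ¬ x.2 < x.1).card := by
    refine Finset.card_bij' (fun x _ => (x.2, x.1)) (fun x _ => (x.2, x.1)) ?_ ?_ ?_ ?_
    · rintro ⟨x, y⟩ hx
      simp only [Finset.mem_filter, Finset.mem_product] at hx ⊢
      exact ⟨⟨hx.1.2, hx.1.1⟩, by omega⟩
    · rintro ⟨x, y⟩ hx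
      simp only [Finset.mem_filter, Finset.mem_product] at hx ⊢
      have : x ≠ y := fun e => Finset.disjoint_left.1 h hx.1.1 (e ▸ hx.1.2)
      exact ⟨⟨hx.1.2, hx.1.1⟩, by omega⟩
    · intros; rfl
    · intros; rfl
  have h2 := Finset.card_filter_add_card_filter_not (s := A ×ˢ B) (fun x => x.2 < x.1)
  unfold sgn
  rw [h1, ← Finset.card_product, ← h2, pow_add, mul_right_comm, ← mul_pow]
  simp

/-- The coefficients of a product. -/
def mulCoeff (a b : SuperNumber) (I : Finset ℕ) : ℝ :=
  ∑ A ∈ I.powerset, sgn A (I \ A) * a.coeff A * b.coeff (I \ A)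

theorem split_injective : Function.Injective
    (fun x : Σ I : Finset ℕ, {A // A ∈ I.powerset} => ((x.2 : Finset ℕ), x.1 \ (x.2 : Finset ℕ))) := by
  rintro ⟨I, A, hA⟩ ⟨J, B, hB⟩ h
  simp only [Prod.mk.injEq] at h
  obtain ⟨rfl, h2⟩ := h
  have : I = J := by
    rw [← Finset.union_sdiff_of_subset (Finset.mem_powerset.1 hA), h2,
      Finset.union_sdiff_of_subset (Finset.mem_powerset.1 hB)]
  subst this
  rfl

theorem mulCoeff_bound (a b : SuperNumber) :
    Summable (fun I => |mulCoeff a b I|) ∧ ∑' I, |mulCoeff a b I| ≤ ‖a‖ * ‖b‖ := by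
  have hprod : Summable fun x : Finset ℕ × Finset ℕ => |a.coeff x.1| * |b.coeff x.2| :=
    a.summable_abs.mul_of_nonneg b.summable_abs (fun _ => abs_nonneg _) (fun _ => abs_nonneg _)
  have hsig := hprod.comp_injective split_injective
  have hfib := hsig.sigma
  have hle : ∀ I, |mulCoeff a b I| ≤ ∑' A : {A // A ∈ I.powerset},
      |a.coeff A| * |b.coeff (I \ (A : Finset ℕ))| := by
    intro I
    rw [tsum_fintype, Finset.sum_coe_sort I.powerset (fun A => |a.coeff A| * |b.coeff (I \ A)|)]
    refine (Finset.abs_sum_le_sum_abs _ _).trans (le_of_eq (Finset.sum_congr rfl ?_))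
    intro A _
    rw [abs_mul, abs_mul, abs_sgn, one_mul]
  have hs : Summable (fun I => |mulCoeff a b I|) :=
    Summable.of_nonneg_of_le (fun _ => abs_nonneg _) hle hfib
  refine ⟨hs, (hs.tsum_le_tsum hle hfib).trans ?_⟩
  have h1 := hsig.tsum_sigma
  simp only [Function.comp_apply] at h1
  rw [← h1, norm_def, norm_def, a.summable_abs.tsum_mul_tsum b.summable_abs hprod]
  exact tsum_comp_le_tsum_of_inj hprod (fun _ => by positivity) split_injective

instance : Mul SuperNumber := ⟨fun a b => mk (mulCoeff a b) (mulCoeff_bound a b).1⟩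

instance : One SuperNumber :=
  ⟨mk (fun I => if I = ∅ then 1 else 0)
    (summable_of_ne_finset_zero (s := {∅}) (by intro I hI; simp_all))⟩

theorem coeff_mul (a b : SuperNumber) (I : Finset ℕ) :
    (a * b).coeff I = ∑ A ∈ I.powerset, sgn A (I \ A) * a.coeff A * b.coeff (I \ A) := rfl

theorem coeff_one (I : Finset ℕ) : (1 : SuperNumber).coeff I = if I = ∅ then 1 else 0 := rfl

theorem mul_assoc' (a b c : SuperNumber) : a * b * c = a * (b * c) := by
  ext I
  simp only [coeff_mul, Finset.mul_sum, Finset.sum_mul]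
  rw [Finset.sum_sigma', Finset.sum_sigma']
  refine Finset.sum_bij' (fun x _ => ⟨x.2, x.1 \ x.2⟩) (fun x _ => ⟨x.1 ∪ x.2, x.1⟩) ?_ ?_ ?_ ?_ ?_
  · rintro ⟨D, A⟩ h
    simp only [Finset.mem_sigma, Finset.mem_powerset] at h ⊢
    exact ⟨h.2.trans h.1, Finset.sdiff_subset_sdiff h.1 le_rfl⟩
  · rintro ⟨A, B⟩ h
    simp only [Finset.mem_sigma, Finset.mem_powerset] at h ⊢
    exact ⟨Finset.union_subset h.1 (h.2.trans Finset.sdiff_subset), Finset.subset_union_left⟩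
  · rintro ⟨D, A⟩ h
    simp only [Finset.mem_sigma, Finset.mem_powerset] at h
    simp [Finset.union_sdiff_of_subset h.2]
  · rintro ⟨A, B⟩ h
    simp only [Finset.mem_sigma, Finset.mem_powerset] at h
    have : Disjoint B A := Finset.disjoint_left.2 fun x hx => (Finset.mem_sdiff.1 (h.2 hx)).2
    simp [Finset.union_sdiff_cancel_left this.symm]
  · rintro ⟨D, A⟩ h
    simp only [Finset.mem_sigma, Finset.mem_powerset] at h
    obtain ⟨hD, hA⟩ := h
    have e1 : (I \ A) \ (D \ A) = I \ D := by
      ext x; simp only [Finset.mem_sdiff]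
      constructor
      · rintro ⟨⟨h1, h2⟩, h3⟩; exact ⟨h1, fun h4 => h3 ⟨h4, h2⟩⟩
      · rintro ⟨h1, h2⟩; exact ⟨⟨h1, fun h3 => h2 (hA h3)⟩, fun h3 => h2 h3.1⟩
    have d1 : Disjoint A (D \ A) := Finset.disjoint_sdiff
    have d2 : Disjoint (D \ A) (I \ D) :=
      Finset.disjoint_left.2 fun x hx hx' =>
        (Finset.mem_sdiff.1 hx').2 (Finset.mem_sdiff.1 hx).1
    have e2 : sgn D (I \ D) = sgn A (I \ D) * sgn (D \ A) (I \ D) := by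
      rw [← sgn_union_left _ d1, Finset.union_sdiff_of_subset hA]
    have e3 : sgn A (I \ A) = sgn A (D \ A) * sgn A (I \ D) := by
      rw [← sgn_union_right _ d2]
      congr 1
      ext x; simp only [Finset.mem_sdiff, Finset.mem_union]
      constructor
      · rintro ⟨h1, h2⟩
        by_cases h3 : x ∈ D
        · exact Or.inl ⟨h3, h2⟩
        · exact Or.inr ⟨h1, h3⟩
      · rintro (⟨h1, h2⟩ | ⟨h1, h2⟩)
        · exact ⟨hD h1, h2⟩
        · exact ⟨h1, fun h3 => h2 (hA h3)⟩
    simp only [e1]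
    rw [e2, e3]
    ring

theorem one_mul' (a : SuperNumber) : 1 * a = a := by
  ext I
  rw [coeff_mul, Finset.sum_eq_single ∅]
  · simp [coeff_one, sgn]
  · intro A _ hA; simp [coeff_one, hA]
  · intro h; simp at h

theorem mul_one' (a : SuperNumber) : a * 1 = a := by
  ext I
  rw [coeff_mul, Finset.sum_eq_single I]
  · simp [coeff_one, sgn]
  · intro A hA hne
    have : I \ A ≠ ∅ := fun h =>
      hne (Finset.Subset.antisymm (Finset.mem_powerset.1 hA) (Finset.sdiff_eq_empty_iff_subset.1 h))
    simp [coeff_one, this]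
  · intro h; simp at h

/-- The supernumbers form a real Banach algebra. -/
instance : NormedRing SuperNumber :=
  { (inferInstance : NormedAddCommGroup SuperNumber) with
    mul := (· * ·)
    one := 1
    mul_assoc := mul_assoc'
    one_mul := one_mul'
    mul_one := mul_one'
    left_distrib := fun a b c => by
      ext I; simp only [coeff_mul, coeff_add, mul_add, Finset.sum_add_distrib]
    right_distrib := fun a b c => by
      ext I; simp only [coeff_mul, coeff_add, mul_add, add_mul, Finset.sum_add_distrib]
    zero_mul := fun a => by ext I; simp [coeff_mul]
    mul_zero := fun a => by ext I; simp [coeff_mul]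
    norm_mul_le := fun a b => by
      rw [norm_def (a * b)]
      exact (mulCoeff_bound a b).2 }

instance : NormedAlgebra ℝ SuperNumber :=
  { Algebra.ofModule
      (fun r a b => by
        ext I; simp only [coeff_mul, coeff_smul, Finset.mul_sum]
        exact Finset.sum_congr rfl fun _ _ => by ring)
      (fun r a b => by
        ext I; simp only [coeff_mul, coeff_smul, Finset.mul_sum]
        exact Finset.sum_congr rfl fun _ _ => by ring) with
    norm_smul_le := fun r a => norm_smul_le r a }

/-- The homogeneous part `Λ^a`: `Λ^0` consists of the even and `Λ^1` of the odd supernumbers. -/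
def part (a : ZMod 2) : Submodule ℝ SuperNumber where
  carrier := {z | ∀ I : Finset ℕ, (I.card : ZMod 2) ≠ a → z.coeff I = 0}
  add_mem' := fun ha hb I hI => by rw [coeff_add, ha I hI, hb I hI, add_zero]
  zero_mem' := fun _ _ => rfl
  smul_mem' := fun c z hz I hI => by rw [coeff_smul, hz I hI, mul_zero]

theorem mem_part {a : ZMod 2} {z : SuperNumber} :
    z ∈ part a ↔ ∀ I : Finset ℕ, (I.card : ZMod 2) ≠ a → z.coeff I = 0 := Iff.rfl

/-- The grading involution: the identity on `Λ^0` and minus the identity on `Λ^1`. -/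
def invol : SuperNumber →L[ℝ] SuperNumber :=
  LinearMap.mkContinuous
    { toFun := fun z => mk (fun I => (-1) ^ I.card * z.coeff I)
        (by simpa [abs_mul, abs_pow] using z.summable_abs)
      map_add' := fun a b => by ext I; simp [mul_add]
      map_smul' := fun c a => by ext I; simp only [coeff_mk, coeff_smul, RingHom.id_apply]; ring }
    1 (fun z => by
      rw [norm_def, norm_def, one_mul]
      simp [abs_mul, abs_pow])

theorem coeff_invol (z : SuperNumber) (I : Finset ℕ) :
    (invol z).coeff I = (-1) ^ I.card * z.coeff I := rfl

theorem mul_comm_even (z : SuperNumber) {h : SuperNumber} (hh : h ∈ part 0) : z * h = h * z := by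
  ext I
  rw [coeff_mul, coeff_mul]
  refine Finset.sum_bij' (fun A _ => I \ A) (fun A _ => I \ A) ?_ ?_ ?_ ?_ ?_
  · intro A _; simp
  · intro A _; simp
  · intro A hA; exact Finset.sdiff_sdiff_eq_self (Finset.mem_powerset.1 hA)
  · intro A hA; exact Finset.sdiff_sdiff_eq_self (Finset.mem_powerset.1 hA)
  · intro A hA
    rw [Finset.sdiff_sdiff_eq_self (Finset.mem_powerset.1 hA)]
    by_cases hp : ((I \ A).card : ZMod 2) = 0
    · rw [sgn_swap (A := A) (B := I \ A) Finset.disjoint_sdiff]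
      have he : Even (I \ A).card := (ZMod.natCast_eq_zero_iff_even).1 hp
      rw [(he.mul_left _).neg_one_pow]
      ring
    · rw [mem_part.1 hh _ hp]; ring

theorem mul_comm_odd (z : SuperNumber) {h : SuperNumber} (hh : h ∈ part 1) :
    z * h = h * invol z := by
  ext I
  rw [coeff_mul, coeff_mul]
  refine Finset.sum_bij' (fun A _ => I \ A) (fun A _ => I \ A) ?_ ?_ ?_ ?_ ?_
  · intro A _; simp
  · intro A _; simp
  · intro A hA; exact Finset.sdiff_sdiff_eq_self (Finset.mem_powerset.1 hA)
  · intro A hA; exact Finset.sdiff_sdiff_eq_self (Finset.mem_powerset.1 hA)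
  · intro A hA
    rw [Finset.sdiff_sdiff_eq_self (Finset.mem_powerset.1 hA), coeff_invol]
    by_cases hp : ((I \ A).card : ZMod 2) = 1
    · rw [sgn_swap (A := A) (B := I \ A) Finset.disjoint_sdiff]
      have he : Odd (I \ A).card := (ZMod.natCast_eq_one_iff_odd).1 hp
      rw [mul_comm A.card, pow_mul, he.neg_one_pow]
      have h2 : ((-1 : ℝ) ^ A.card) * (-1) ^ A.card = 1 := by rw [← mul_pow]; simp
      linear_combination (-(sgn A (I \ A) * z.coeff A * h.coeff (I \ A))) * h2
    · rw [mem_part.1 hh _ hp]; ring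

end SuperNumber

open SuperNumber

/-- The sign `(-1)^{ab}` of the rule of signs. -/
def koszul (a b : ZMod 2) : ℝ := if a = 1 ∧ b = 1 then -1 else 1

/-! ## Superspace and `G^∞` functions -/

/-- Parity of the `k`-th coordinate of `ℝ^{m|n}`: `m` even coordinates, `n` odd ones. -/
def parity {m n : ℕ} : Fin m ⊕ Fin n → ZMod 2 := Sum.elim (fun _ => 0) (fun _ => 1)

/-- The superspace `ℝ^{m|n} = (Λ^0)^m × (Λ^1)^n` with the norm `∑ ‖x^i‖ + ∑ ‖θ^α‖`. -/
abbrev SuperSpace (m n : ℕ) : Type :=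
  PiLp 1 (fun k : Fin m ⊕ Fin n => part (parity k))

variable {m n : ℕ}

/-- `f` is superdifferentiable at `x` with partial derivatives `f' k`:
`f (x + h) = f x + ∑ h^k * f' k + o(‖h‖)`. -/
def HasSuperDerivAt (f : SuperSpace m n → SuperNumber) (f' : Fin m ⊕ Fin n → SuperNumber)
    (x : SuperSpace m n) : Prop :=
  ∃ L : SuperSpace m n →L[ℝ] SuperNumber,
    (∀ h, L h = ∑ k, (h k : SuperNumber) * f' k) ∧ HasFDerivAt f L x

/-- `f` is of class `G^r` on the open set `U`. -/
def IsG : ℕ → (SuperSpace m n → SuperNumber) → Set (SuperSpace m n) → Prop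
  | 0, f, U => ContinuousOn f U
  | r + 1, f, U => ∃ f' : Fin m ⊕ Fin n → SuperSpace m n → SuperNumber,
      (∀ k, IsG r (f' k) U) ∧ ∀ x ∈ U, HasSuperDerivAt f (fun k => f' k x) x

/-- `f` is of class `G^∞` (supersmooth) on the open set `U`. -/
def IsGInfty (f : SuperSpace m n → SuperNumber) (U : Set (SuperSpace m n)) : Prop :=
  ∀ r, IsG r f U

theorem IsG.mono {U V : Set (SuperSpace m n)} (hVU : V ⊆ U) :
    ∀ {r : ℕ} {f : SuperSpace m n → SuperNumber}, IsG r f U → IsG r f V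
  | 0, _, h => ContinuousOn.mono h hVU
  | _ + 1, _, ⟨f', h1, h2⟩ => ⟨f', fun k => (h1 k).mono hVU, fun x hx => h2 x (hVU hx)⟩

theorem IsG.of_succ {U : Set (SuperSpace m n)} :
    ∀ {r : ℕ} {f : SuperSpace m n → SuperNumber}, IsG (r + 1) f U → IsG r f U
  | 0, _, ⟨_, _, h2⟩ => fun x hx => by
      obtain ⟨L, _, hL⟩ := h2 x hx
      exact hL.continuousAt.continuousWithinAt
  | _ + 1, _, ⟨f', h1, h2⟩ => ⟨f', fun k => (h1 k).of_succ, h2⟩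

theorem isG_const (c : SuperNumber) (U : Set (SuperSpace m n)) :
    ∀ r : ℕ, IsG r (fun _ => c) U := by
  intro r
  induction r generalizing c with
  | zero => exact continuousOn_const
  | succ r ih =>
    exact ⟨fun _ _ => 0, fun _ => ih 0, fun x _ => ⟨0, by simp, hasFDerivAt_const c x⟩⟩

theorem IsG.add {U : Set (SuperSpace m n)} :
    ∀ {r : ℕ} {f g : SuperSpace m n → SuperNumber}, IsG r f U → IsG r g U →
      IsG r (fun x => f x + g x) U
  | 0, _, _, hf, hg => ContinuousOn.add hf hg
  | _ + 1, _, _, ⟨f', hf1, hf2⟩, ⟨g', hg1, hg2⟩ =>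
    ⟨fun k x => f' k x + g' k x, fun k => (hf1 k).add (hg1 k), fun x hx => by
      obtain ⟨L, hL, hL'⟩ := hf2 x hx
      obtain ⟨N, hN, hN'⟩ := hg2 x hx
      exact ⟨L + N, fun h => by simp [hL, hN, mul_add, Finset.sum_add_distrib], hL'.add hN'⟩⟩

theorem isG_const_smul {U : Set (SuperSpace m n)} (c : ℝ) :
    ∀ {r : ℕ} {f : SuperSpace m n → SuperNumber}, IsG r f U → IsG r (fun x => c • f x) U
  | 0, _, hf => ContinuousOn.const_smul hf c
  | _ + 1, _, ⟨f', hf1, hf2⟩ =>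
    ⟨fun k x => c • f' k x, fun k => isG_const_smul c (hf1 k), fun x hx => by
      obtain ⟨L, hL, hL'⟩ := hf2 x hx
      exact ⟨c • L, fun h => by simp [hL, Finset.smul_sum], hL'.const_smul c⟩⟩

theorem invol_mul_of_mem {a : ZMod 2} {h : SuperNumber} (hh : h ∈ part a) (z : SuperNumber) :
    invol (h * z) = h * (koszul a 1 • invol z) := by
  ext I
  rw [coeff_invol, coeff_mul, coeff_mul, Finset.mul_sum]
  refine Finset.sum_congr rfl fun A hA => ?_
  rw [coeff_smul, coeff_invol]
  by_cases hp : (A.card : ZMod 2) = a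
  · have hc : I.card = A.card + (I \ A).card := by
      rw [Finset.card_sdiff_of_subset (Finset.mem_powerset.1 hA)]
      have := Finset.card_le_card (Finset.mem_powerset.1 hA)
      omega
    have hs : ((-1 : ℝ) ^ A.card) = koszul a 1 := by
      unfold koszul
      rcases Nat.even_or_odd A.card with he | ho
      · have : a = 0 := hp ▸ (ZMod.natCast_eq_zero_iff_even).2 he
        rw [he.neg_one_pow, this]; simp
      · have : a = 1 := hp ▸ (ZMod.natCast_eq_one_iff_odd).2 ho
        rw [ho.neg_one_pow, this]; simp
    rw [hc, pow_add, hs]; ring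
  · rw [mem_part.1 hh _ hp]; ring

theorem IsG.invol {U : Set (SuperSpace m n)} :
    ∀ {r : ℕ} {f : SuperSpace m n → SuperNumber}, IsG r f U → IsG r (fun x => invol (f x)) U
  | 0, _, hf => SuperNumber.invol.continuous.comp_continuousOn hf
  | _ + 1, _, ⟨f', hf1, hf2⟩ =>
    ⟨fun k x => koszul (parity k) 1 • SuperNumber.invol (f' k x),
      fun k => isG_const_smul _ (hf1 k).invol, fun x hx => by
        obtain ⟨L, hL, hL'⟩ := hf2 x hx
        refine ⟨SuperNumber.invol.comp L, fun h => ?_, SuperNumber.invol.hasFDerivAt.comp x hL'⟩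
        rw [ContinuousLinearMap.comp_apply, hL, map_sum]
        exact Finset.sum_congr rfl fun k _ => invol_mul_of_mem (h k).2 _⟩

theorem IsG.mul {U : Set (SuperSpace m n)} {r : ℕ} {f g : SuperSpace m n → SuperNumber}
    (hf : IsG r f U) (hg : IsG r g U) : IsG r (fun x => f x * g x) U := by
  induction r generalizing f g with
  | zero => exact ContinuousOn.mul hf hg
  | succ r ih =>
    have hf0 := hf.of_succ
    have hg0 := hg.of_succ
    obtain ⟨f', hf1, hf2⟩ := hf
    obtain ⟨g', hg1, hg2⟩ := hg
    refine ⟨fun k x => f' k x * g x +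
      (if parity k = 0 then f x else SuperNumber.invol (f x)) * g' k x, fun k => ?_, fun x hx => ?_⟩
    · refine (ih (hf1 k) hg0).add (ih ?_ (hg1 k))
      split_ifs
      · exact hf0
      · exact hf0.invol
    · obtain ⟨L, hL, hL'⟩ := hf2 x hx
      obtain ⟨N, hN, hN'⟩ := hg2 x hx
      refine ⟨_, fun h => ?_, hL'.mul' hN'⟩
      simp only [_root_.add_apply, _root_.smul_apply,
        MulOpposite.smul_eq_mul_unop, MulOpposite.unop_op, hL, hN, smul_eq_mul, Finset.sum_mul,
        Finset.mul_sum, mul_add, Finset.sum_add_distrib]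
      rw [add_comm]
      congr 1
      · simp only [mul_assoc]
      · refine Finset.sum_congr rfl fun k _ => ?_
        rw [← mul_assoc, ← mul_assoc]
        congr 1
        rcases k with i | j
        · simpa [parity] using mul_comm_even (f x) (h (Sum.inl i)).2
        · simpa [parity] using mul_comm_odd (f x) (h (Sum.inr j)).2

/-! ## Supermanifolds -/

/-- `M` with its atlas of charts in `ℝ^{m|n}` is a `G^∞` supermanifold of dimension `(m, n)`: the
components of all transition maps are of class `G^∞`. -/
class IsSuperManifold (m n : ℕ) (M : Type*) [TopologicalSpace M]
    [ChartedSpace (SuperSpace m n) M] : Prop where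
  compatible : ∀ e ∈ atlas (SuperSpace m n) M, ∀ e' ∈ atlas (SuperSpace m n) M,
    ∀ k, IsGInfty (fun x => ((e' (e.symm x)) k : SuperNumber)) (e.symm.trans e').source

section Manifold

variable (m n) {M : Type*} [TopologicalSpace M] [ChartedSpace (SuperSpace m n) M]

/-- `f` is of class `G^∞` on the open subset `U` of `M`. -/
def IsGInftyOn (f : M → SuperNumber) (U : Set M) : Prop :=
  ∀ e ∈ atlas (SuperSpace m n) M, IsGInfty (fun x => f (e.symm x)) (e.target ∩ e.symm ⁻¹' U)

/-- `f` is of class `G^∞` on a neighbourhood of `p`. -/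
def IsGInftyAt (f : M → SuperNumber) (p : M) : Prop :=
  ∃ U : Set M, IsOpen U ∧ p ∈ U ∧ IsGInftyOn m n f U

variable {m n} in
theorem IsGInftyAt.map₂ {f g : M → SuperNumber} {p : M} (op : SuperNumber → SuperNumber → SuperNumber)
    (hop : ∀ (V : Set (SuperSpace m n)) (F G : SuperSpace m n → SuperNumber) (r : ℕ),
      IsG r F V → IsG r G V → IsG r (fun x => op (F x) (G x)) V)
    (hf : IsGInftyAt m n f p) (hg : IsGInftyAt m n g p) :
    IsGInftyAt m n (fun q => op (f q) (g q)) p := by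
  obtain ⟨U, hU, hpU, hfU⟩ := hf
  obtain ⟨V, hV, hpV, hgV⟩ := hg
  refine ⟨U ∩ V, hU.inter hV, ⟨hpU, hpV⟩, fun e he r => hop _ _ _ r ?_ ?_⟩
  · exact (hfU e he r).mono (Set.inter_subset_inter_right _ fun x hx => hx.1)
  · exact (hgV e he r).mono (Set.inter_subset_inter_right _ fun x hx => hx.2)

theorem isGInftyAt_const (c : SuperNumber) (p : M) : IsGInftyAt m n (fun _ => c) p :=
  ⟨Set.univ, isOpen_univ, trivial, fun _ _ r => isG_const c _ r⟩

/-- The ring of germs at `p` of `G^∞` functions. -/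
def SmoothGerm (p : M) : Subring (Germ (𝓝 p) SuperNumber) where
  carrier := {F | ∃ f : M → SuperNumber, IsGInftyAt m n f p ∧ (f : Germ (𝓝 p) SuperNumber) = F}
  mul_mem' := by
    rintro _ _ ⟨f, hf, rfl⟩ ⟨g, hg, rfl⟩
    exact ⟨_, hf.map₂ (· * ·) (fun _ _ _ _ h1 h2 => h1.mul h2) hg, rfl⟩
  one_mem' := ⟨_, isGInftyAt_const m n 1 p, rfl⟩
  add_mem' := by
    rintro _ _ ⟨f, hf, rfl⟩ ⟨g, hg, rfl⟩
    exact ⟨_, hf.map₂ (· + ·) (fun _ _ _ _ h1 h2 => h1.add h2) hg, rfl⟩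
  zero_mem' := ⟨_, isGInftyAt_const m n 0 p, rfl⟩
  neg_mem' := by
    rintro _ ⟨f, hf, rfl⟩
    refine ⟨_, (isGInftyAt_const m n (-1) p).map₂ (· * ·) (fun _ _ _ _ h1 h2 => h1.mul h2) hf, ?_⟩
    exact congrArg _ (funext fun x => neg_one_mul (f x))

/-- The germ of a constant function. -/
def constGerm (p : M) (c : SuperNumber) : SmoothGerm m n p :=
  ⟨((fun _ => c : M → SuperNumber) : Germ (𝓝 p) SuperNumber), _, isGInftyAt_const m n c p, rfl⟩

/-- `X` is a homogeneous tangent vector of parity `a` at `p`: a graded derivation of parity `a`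
from the germs of `G^∞` functions at `p` to the supernumbers, graded linear over the
supernumbers. -/
structure IsHomogeneousVector (p : M) (a : ZMod 2) (X : SmoothGerm m n p → SuperNumber) : Prop where
  map_add : ∀ F G : SmoothGerm m n p, X (F + G) = X F + X G
  map_const_mul : ∀ (b : ZMod 2), ∀ c ∈ part b, ∀ F : SmoothGerm m n p,
    X (constGerm m n p c * F) = koszul a b • (c * X F)
  leibniz : ∀ (b : ZMod 2) (F G : SmoothGerm m n p), (F : Germ (𝓝 p) SuperNumber).LiftPred (· ∈ part b) →
    X (F * G) = X F * (G : Germ (𝓝 p) SuperNumber).value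
      + koszul a b • ((F : Germ (𝓝 p) SuperNumber).value * X G)
  map_parity : ∀ (b : ZMod 2) (F : SmoothGerm m n p), (F : Germ (𝓝 p) SuperNumber).LiftPred (· ∈ part b) →
    X F ∈ part (a + b)

/-- The tangent space `T_pM`: the left module over the supernumbers consisting of the sums of an
even and an odd graded derivation (these sums are closed under left multiplication by
supernumbers), acting by `(c • X) F = c * X F`. -/
def SuperTangent (p : M) : Submodule SuperNumber (SmoothGerm m n p → SuperNumber) :=
  Submodule.span SuperNumber {X | ∃ a, IsHomogeneousVector m n p a X}

variable {m n} in
/-- A tangent vector is pure of parity `a`. -/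
def IsPure {p : M} (a : ZMod 2) (X : SuperTangent m n p) : Prop :=
  IsHomogeneousVector m n p a (X : SmoothGerm m n p → SuperNumber)

open Classical in
variable {m n} in
/-- The value `X f` for a function `f` of class `G^∞` near `p` (and `0` for other functions). -/
def applyFun {p : M} (X : SuperTangent m n p) (f : M → SuperNumber) : SuperNumber :=
  if h : IsGInftyAt m n f p then
    (X : SmoothGerm m n p → SuperNumber) ⟨(f : Germ (𝓝 p) SuperNumber), f, h, rfl⟩
  else 0

variable {m n} in
/-- `X` is a super vector field on the open set `U` (its values outside `U` are irrelevant): it maps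
`G^∞` functions to `G^∞` functions. -/
def IsVectorFieldOn (X : ∀ p : M, SuperTangent m n p) (U : Set M) : Prop :=
  ∀ V ⊆ U, IsOpen V → ∀ f : M → SuperNumber, IsGInftyOn m n f V →
    IsGInftyOn m n (fun q => applyFun (X q) f) V

variable (M) in
/-- An (even) super Riemannian metric on `M`. -/
structure SuperRiemannianMetric where
  /-- The value `g_p(x, y)`. -/
  val : ∀ p : M, SuperTangent m n p → SuperTangent m n p → SuperNumber
  smooth : ∀ U : Set M, IsOpen U → ∀ X Y : ∀ p : M, SuperTangent m n p,
    IsVectorFieldOn X U → IsVectorFieldOn Y U →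
      IsGInftyOn m n (fun q => val q (X q) (Y q)) U
  linear_left : ∀ p (c d : SuperNumber) (x y z : SuperTangent m n p),
    val p (c • x + d • y) z = c * val p x z + d * val p y z
  add_right : ∀ p (x y z : SuperTangent m n p), val p x (y + z) = val p x y + val p x z
  symm : ∀ p (a b : ZMod 2) (x y : SuperTangent m n p), IsPure a x → IsPure b y →
    val p x y = koszul a b • val p y x
  even : ∀ p (a b : ZMod 2) (x y : SuperTangent m n p), IsPure a x → IsPure b y →
    val p x y ∈ part (a + b)
  nondegenerate : ∀ p (z : SuperTangent m n p), (∀ x, val p x z = 0) ↔ z = 0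
  /-- Nondegeneracy over the ring of supernumbers: `z ↦ g_p(·, z)` is onto the dual module. -/
  perfect : ∀ p (φ : SuperTangent m n p →ₗ[SuperNumber] SuperNumber),
    ∃ z : SuperTangent m n p, ∀ x, val p x z = φ x

end Manifold

/-- The block diagonal matrix of size `n` (meant for even `n`) with the blocks `(0, 1; -1, 0)`. -/
def blockJ (n : ℕ) : Matrix (Fin n) (Fin n) SuperNumber := Matrix.of fun α β =>
  if Even (α : ℕ) ∧ (β : ℕ) = α + 1 then 1
  else if Even (β : ℕ) ∧ (α : ℕ) = β + 1 then -1 else 0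

end

end SuperGeometry

/-!
The coordinate fields of a chart at `p` form a pure frame near `p`. The body of its Gram matrix at
`p` is an invertible real matrix, symmetric on the even fields, skew-symmetric on the odd ones and
zero between them; so `n` is even, and a change of frame with real coefficients makes this body
diagonal on the even part and, up to nonzero factors, `𝒥` on the odd part. An even supernumber is
invertible as soon as its body is nonzero, which is an open condition. The Gram–Schmidt coefficients
have zero body at `p`, so each step leaves the body of the Gram matrix at `p` unchanged. Hence all
pivots stay invertible near `p` while one even field, or one pair of odd fields, after the other is
made orthogonal to the rest. No square roots are taken: the diagonal entries `d i` remain arbitrary,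
and each odd pair is normalized by multiplying one of its fields by an inverse.
-/

namespace SuperGeometry

noncomputable section

open SuperNumber

theorem zmod_two_cases : ∀ a : ZMod 2, a = 0 ∨ a = 1 := by decide

@[simp] theorem koszul_zero_left (a : ZMod 2) : koszul 0 a = 1 := by simp [koszul]

@[simp] theorem koszul_zero_right (a : ZMod 2) : koszul a 0 = 1 := by simp [koszul]

@[simp] theorem koszul_one_one : koszul 1 1 = -1 := by simp [koszul]

theorem koszul_comm (a b : ZMod 2) : koszul a b = koszul b a := by
  simp only [koszul, and_comm]

theorem koszul_add_left (a b c : ZMod 2) : koszul (a + b) c = koszul a c * koszul b c := by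
  rcases zmod_two_cases a with rfl | rfl <;> rcases zmod_two_cases b with rfl | rfl <;>
    rcases zmod_two_cases c with rfl | rfl <;> simp [CharTwo.add_self_eq_zero]

theorem koszul_mul_self (a b : ZMod 2) : koszul a b * koszul a b = 1 := by
  rcases zmod_two_cases a with rfl | rfl <;> rcases zmod_two_cases b with rfl | rfl <;> simp

theorem isUnit_add_of_mem_closure_nilradical {R : Type*} [NormedCommRing R] [CompleteSpace R]
    {u x : R} (hu : IsUnit u) (hx : x ∈ closure (nilradical R : Set R)) : IsUnit (u + x) := by
  have hcont : ContinuousAt (fun y => u + (x - y)) x := by fun_prop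
  have hnear : ∀ᶠ y in 𝓝 x, IsUnit (u + (x - y)) :=
    hcont.eventually (Units.isOpen.mem_nhds (by simpa using hu))
  obtain ⟨y, hy, hynil⟩ := mem_closure_iff_nhds.1 hx _ hnear
  have hunit := IsNilpotent.isUnit_add_left_of_commute (mem_nilradical.1 hynil) hy (Commute.all _ _)
  convert hunit using 1
  abel

namespace SuperNumber

/-- The coefficient of `ζ^I` as a continuous linear functional. -/
def coeffCLM (I : Finset ℕ) : SuperNumber →L[ℝ] ℝ :=
  LinearMap.mkContinuous
    { toFun := fun z => z.coeff I
      map_add' := fun _ _ => rfl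
      map_smul' := fun _ _ => rfl }
    1 (fun z => by
      rw [norm_def, one_mul]
      exact z.summable_abs.le_tsum I (fun _ _ => abs_nonneg _))

@[simp] theorem coeffCLM_apply (I : Finset ℕ) (z : SuperNumber) : coeffCLM I z = z.coeff I := rfl

/-- The body of a supernumber: its coefficient at the empty multi-index. -/
def body : SuperNumber →+* ℝ where
  toFun z := z.coeff ∅
  map_one' := by simp [coeff_one]
  map_mul' a b := by simp [coeff_mul, sgn]
  map_zero' := rfl
  map_add' _ _ := rfl

theorem continuous_body : Continuous body := (coeffCLM ∅).continuous

@[simp] theorem body_smul (c : ℝ) (z : SuperNumber) : body (c • z) = c * body z := rfl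

theorem body_of_odd {z : SuperNumber} (hz : z ∈ part 1) : body z = 0 :=
  hz ∅ (by simp)

theorem one_mem_part : (1 : SuperNumber) ∈ part 0 := fun I hI => by
  rw [coeff_one, if_neg]
  rintro rfl
  simp at hI

theorem algebraMap_mem_part (r : ℝ) : algebraMap ℝ SuperNumber r ∈ part 0 := by
  rw [Algebra.algebraMap_eq_smul_one]
  exact (part 0).smul_mem r one_mem_part

@[simp] theorem body_algebraMap (r : ℝ) : body (algebraMap ℝ SuperNumber r) = r := by
  rw [Algebra.algebraMap_eq_smul_one, body_smul, map_one, mul_one]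

theorem isClosed_part (a : ZMod 2) : IsClosed (part a : Set SuperNumber) := by
  have hinter : (part a : Set SuperNumber)
      = ⋂ (I : Finset ℕ) (_ : (I.card : ZMod 2) ≠ a), coeffCLM I ⁻¹' {0} := by
    ext z
    simp [mem_part]
  rw [hinter]
  exact isClosed_iInter fun I => isClosed_iInter fun _ =>
    isClosed_singleton.preimage (coeffCLM I).continuous

theorem mul_mem_part {a b : ZMod 2} {x y : SuperNumber} (hx : x ∈ part a) (hy : y ∈ part b) :
    x * y ∈ part (a + b) := fun I hI => by
  rw [coeff_mul]
  refine Finset.sum_eq_zero fun A hA => ?_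
  by_cases hAa : (A.card : ZMod 2) = a
  · by_cases hAb : ((I \ A).card : ZMod 2) = b
    · refine absurd ?_ hI
      rw [← hAa, ← hAb, ← Nat.cast_add, add_comm,
        Finset.card_sdiff_add_card_eq_card (Finset.mem_powerset.1 hA)]
    · rw [hy _ hAb, mul_zero]
  · rw [hx _ hAa, mul_zero, zero_mul]

theorem invol_of_mem {a : ZMod 2} {z : SuperNumber} (hz : z ∈ part a) :
    invol z = koszul a 1 • z := by
  have hone : invol (1 : SuperNumber) = 1 := by
    ext I
    rw [coeff_invol, coeff_one]
    split_ifs with hI <;> simp [hI]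
  simpa [hone] using invol_mul_of_mem hz 1

theorem mul_comm_of_mem {a b : ZMod 2} {x y : SuperNumber} (hx : x ∈ part a) (hy : y ∈ part b) :
    x * y = koszul a b • (y * x) := by
  rcases zmod_two_cases b with rfl | rfl
  · rw [mul_comm_even x hy, koszul_zero_right, one_smul]
  · rw [mul_comm_odd x hy, invol_of_mem hx, mul_smul_comm]

/-- The projection of a supernumber to its homogeneous part of parity `a`. -/
def proj (a : ZMod 2) : SuperNumber →L[ℝ] part a :=
  ((1 / 2 : ℝ) • (ContinuousLinearMap.id ℝ SuperNumber + koszul a 1 • invol)).codRestrict (part a)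
    (fun z I hI => by
      simp only [_root_.smul_apply, _root_.add_apply, ContinuousLinearMap.id_apply, coeff_smul,
        coeff_add, coeff_invol]
      rcases zmod_two_cases a with rfl | rfl
      · have hodd : Odd I.card :=
          Nat.not_even_iff_odd.1 fun h => hI ((ZMod.natCast_eq_zero_iff_even).2 h)
        simp [hodd.neg_one_pow]
      · have heven : Even I.card :=
          Nat.not_odd_iff_even.1 fun h => hI ((ZMod.natCast_eq_one_iff_odd).2 h)
        simp [heven.neg_one_pow])

theorem coe_proj (a : ZMod 2) (z : SuperNumber) :
    (proj a z : SuperNumber) = (1 / 2 : ℝ) • (z + koszul a 1 • invol z) := rfl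

theorem proj_of_mem {a : ZMod 2} {z : SuperNumber} (hz : z ∈ part a) :
    (proj a z : SuperNumber) = z := by
  rw [coe_proj, invol_of_mem hz, smul_smul, koszul_mul_self]
  module

theorem proj_add_proj (z : SuperNumber) :
    (proj 0 z : SuperNumber) + (proj 1 z : SuperNumber) = z := by
  rw [coe_proj, coe_proj, koszul_zero_left, koszul_one_one]
  module

/-- The monomial `ζ^I`. -/
def monomial (I : Finset ℕ) : SuperNumber :=
  mk (fun J => if J = I then 1 else 0)
    (summable_of_ne_finset_zero (s := {I}) (by intro J hJ; simp_all))

theorem coeff_monomial (I J : Finset ℕ) : (monomial I).coeff J = if J = I then 1 else 0 := rfl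

theorem monomial_mem_part (I : Finset ℕ) : monomial I ∈ part I.card := fun J hJ => by
  rw [coeff_monomial, if_neg]
  rintro rfl
  exact hJ rfl

theorem coeff_monomial_mul {I J : Finset ℕ} (h : Disjoint I J) (z : SuperNumber) :
    (monomial I * z).coeff (I ∪ J) = sgn I J * z.coeff J := by
  rw [coeff_mul, Finset.sum_eq_single I]
  · rw [coeff_monomial, if_pos rfl, mul_one, Finset.union_sdiff_cancel_left h]
  · intro A _ hA
    rw [coeff_monomial, if_neg hA, mul_zero, zero_mul]
  · exact fun hI => absurd (Finset.mem_powerset.2 Finset.subset_union_left) hI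

theorem sgn_ne_zero (A B : Finset ℕ) : sgn A B ≠ 0 :=
  abs_ne_zero.1 ((abs_sgn A B).trans_ne one_ne_zero)

theorem mem_part_of_forall_mul {a b : ZMod 2} {z : SuperNumber}
    (h : ∀ x ∈ part a, x * z ∈ part b) : z ∈ part (a + b) := by
  rcases zmod_two_cases a with rfl | rfl
  · simpa using h 1 one_mem_part
  · intro I hI
    -- infinitely many generators: some `ζ^j` does not occur in `ζ^I`, so `ζ^j ζ^I ≠ 0`
    obtain ⟨j, hj⟩ := Infinite.exists_notMem_finset I
    have hdisj : Disjoint {j} I := Finset.disjoint_singleton_left.2 hj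
    have hcard : (({j} ∪ I : Finset ℕ).card : ZMod 2) ≠ b := by
      rw [Finset.card_union_of_disjoint hdisj, Finset.card_singleton, Nat.cast_add, Nat.cast_one]
      rintro rfl
      exact hI (by rw [← add_assoc, CharTwo.add_self_eq_zero, zero_add])
    have hcoeff := h (monomial {j}) (by simpa using monomial_mem_part {j}) _ hcard
    rw [coeff_monomial_mul hdisj] at hcoeff
    exact (mul_eq_zero.1 hcoeff).resolve_left (sgn_ne_zero _ _)

theorem eq_zero_of_forall_mul {a : ZMod 2} {z : SuperNumber} (h : ∀ x ∈ part a, x * z = 0) :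
    z = 0 := by
  have hz : ∀ b, z ∈ part (a + b) :=
    fun b => mem_part_of_forall_mul fun x hx => by rw [h x hx]; exact zero_mem _
  ext I
  exact hz (I.card + 1 - a) I (by rw [add_sub_cancel]; simp)

theorem monomial_mul_self {I : Finset ℕ} (hI : I.Nonempty) : monomial I * monomial I = 0 := by
  ext J
  rw [coeff_mul, coeff_zero]
  refine Finset.sum_eq_zero fun A _ => ?_
  rw [coeff_monomial, coeff_monomial]
  rcases eq_or_ne A I with rfl | hA
  · have hsdiff : J \ A ≠ A := fun h => hI.ne_empty (Finset.disjoint_self_iff_empty _ |>.1 (by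
      nth_rw 1 [← h]
      exact Finset.sdiff_disjoint))
    rw [if_neg hsdiff, mul_zero]
  · rw [if_neg hA, mul_zero, zero_mul]

theorem hasSum_coeff_smul_monomial (z : SuperNumber) :
    HasSum (fun I => z.coeff I • monomial I) z := by
  have hsingle : HasSum (fun I => (lp.single 1 I (z.coeff I) : lp (fun _ : Finset ℕ => ℝ) 1)) z :=
    lp.hasSum_single (E := fun _ : Finset ℕ => ℝ) (p := 1) (by simp) z
  have hterm : (fun I => z.coeff I • monomial I)
      = fun I => (lp.single 1 I (z.coeff I) : lp (fun _ : Finset ℕ => ℝ) 1) := by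
    funext I
    refine SuperNumber.ext fun J => ?_
    rw [coeff_smul, coeff_monomial, mul_ite, mul_one, mul_zero]
    exact (Pi.single_apply I (z.coeff I) J).symm
  rw [hterm]
  exact hsingle

/-- The Banach algebra `Λ^0` of even supernumbers. It is commutative, so that the theory of
nilpotent elements and units of commutative rings applies to it. -/
def evenSubalgebra : Subalgebra ℝ SuperNumber where
  carrier := part 0
  mul_mem' := fun ha hb => mul_mem_part ha hb
  add_mem' := fun ha hb => add_mem ha hb
  algebraMap_mem' := algebraMap_mem_part

instance : NormedCommRing evenSubalgebra :=
  { (inferInstance : NormedRing evenSubalgebra) with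
    mul_comm := fun _ b => Subtype.ext (mul_comm_even _ b.2) }

instance : CompleteSpace evenSubalgebra := (isClosed_part 0).completeSpace_coe

theorem coeff_smul_monomial_mem_part {a : ZMod 2} {z : SuperNumber} (hz : z ∈ part a)
    (I : Finset ℕ) : z.coeff I • monomial I ∈ part a := by
  by_cases hI : (I.card : ZMod 2) = a
  · exact (part a).smul_mem _ (hI ▸ monomial_mem_part I)
  · rw [hz I hI, zero_smul]
    exact zero_mem _

theorem even_sub_body_mem_closure_nilradical (z : evenSubalgebra) :
    z - algebraMap ℝ evenSubalgebra (body z) ∈ closure (nilradical evenSubalgebra : Set _) := by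
  let term (I : Finset ℕ) : evenSubalgebra :=
    ⟨(z : SuperNumber).coeff I • monomial I, coeff_smul_monomial_mem_part z.2 I⟩
  have hsum : HasSum term z :=
    (Topology.IsInducing.subtypeVal.hasSum_iff (g := evenSubalgebra.val) term z).1
      (hasSum_coeff_smul_monomial z)
  have hempty : term ∅ = algebraMap ℝ evenSubalgebra (body z) :=
    Subtype.ext (Algebra.algebraMap_eq_smul_one (A := SuperNumber) (body z)).symm
  have hsoul : HasSum (Function.update term ∅ 0) (z - algebraMap ℝ evenSubalgebra (body z)) := by
    simpa [hempty, sub_eq_neg_add] using hsum.update ∅ 0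
  refine mem_closure_of_tendsto hsoul (Eventually.of_forall fun s => sum_mem fun I _ => ?_)
  rcases I.eq_empty_or_nonempty with rfl | hI
  · simp
  · rw [Function.update_of_ne hI.ne_empty]
    refine mem_nilradical.2 ⟨2, Subtype.ext ?_⟩
    change (_ • monomial I) ^ 2 = 0
    rw [pow_two, smul_mul_smul_comm, monomial_mul_self hI, smul_zero]

theorem isUnit_even_of_body_ne_zero {z : evenSubalgebra} (hz : body z ≠ 0) : IsUnit z := by
  have hbody : IsUnit (algebraMap ℝ evenSubalgebra (body z)) := hz.isUnit.map _
  simpa using isUnit_add_of_mem_closure_nilradical hbody (even_sub_body_mem_closure_nilradical z)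

section Inverse

variable {z : SuperNumber}

theorem isUnit_of_mem_part_zero (hz : z ∈ part 0) (hb : body z ≠ 0) : IsUnit z :=
  (isUnit_even_of_body_ne_zero (z := ⟨z, hz⟩) hb).map evenSubalgebra.val

theorem ringInverse_mem_part_zero (hz : z ∈ part 0) (hb : body z ≠ 0) :
    Ring.inverse z ∈ part 0 := by
  obtain ⟨u, hu⟩ := isUnit_even_of_body_ne_zero (z := ⟨z, hz⟩) hb
  have hz_eq : z = Units.map (evenSubalgebra.val : evenSubalgebra →* SuperNumber) u :=
    (congrArg Subtype.val hu).symm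
  rw [hz_eq, Ring.inverse_unit]
  exact (u⁻¹).1.2

end Inverse

end SuperNumber

section Calculus

variable {m n : ℕ}

/-- The `k`-th coordinate of `ℝ^{m|n}` as a continuous linear map. -/
def coordCLM (k : Fin m ⊕ Fin n) : SuperSpace m n →L[ℝ] SuperNumber :=
  (part (parity k)).subtypeL.comp
    (PiLp.proj 1 (𝕜 := ℝ) (fun k : Fin m ⊕ Fin n => part (parity k)) k)

/-- The continuous linear map `h ↦ ∑ h^k * c k`: the Fréchet derivative of a superdifferentiable
function with partial derivatives `c k`. -/
def superLinear (c : Fin m ⊕ Fin n → SuperNumber) : SuperSpace m n →L[ℝ] SuperNumber :=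
  ∑ k, ((ContinuousLinearMap.mul ℝ SuperNumber).flip (c k)).comp (coordCLM k)

@[simp] theorem superLinear_apply (c : Fin m ⊕ Fin n → SuperNumber) (h : SuperSpace m n) :
    superLinear c h = ∑ k, (h k : SuperNumber) * c k := by
  simp [superLinear, coordCLM]

theorem continuous_superLinear : Continuous (superLinear (m := m) (n := n)) := by
  unfold superLinear
  refine continuous_finsetSum _ fun k _ => ?_
  exact ((ContinuousLinearMap.mul ℝ SuperNumber).flip.continuous.comp
    (continuous_apply k)).clm_comp continuous_const

theorem hasSuperDerivAt_iff {f : SuperSpace m n → SuperNumber} {f' : Fin m ⊕ Fin n → SuperNumber}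
    {x : SuperSpace m n} : HasSuperDerivAt f f' x ↔ HasFDerivAt f (superLinear f') x := by
  constructor
  · rintro ⟨L, hL, hf⟩
    have hL_eq : superLinear f' = L :=
      ContinuousLinearMap.ext fun h => by rw [hL, superLinear_apply]
    rwa [hL_eq]
  · exact fun h => ⟨_, superLinear_apply f', h⟩

/-- The vector with `k`-th coordinate `c` and all other coordinates zero. -/
def coordVector (k : Fin m ⊕ Fin n) (c : part (parity k)) : SuperSpace m n :=
  WithLp.toLp 1 (Pi.single k c)

theorem superLinear_coordVector (c : Fin m ⊕ Fin n → SuperNumber) (k : Fin m ⊕ Fin n)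
    (h : part (parity k)) : superLinear c (coordVector k h) = h * c k := by
  rw [superLinear_apply, Finset.sum_eq_single k]
  · simp [coordVector]
  · intro j _ hj
    simp [coordVector, hj]
  · simp

theorem superLinear_injective : Function.Injective (superLinear (m := m) (n := n)) := by
  intro c d h
  funext k
  refine sub_eq_zero.1 (eq_zero_of_forall_mul (a := parity k) fun x hx => ?_)
  have happly := DFunLike.congr_fun h (coordVector k ⟨x, hx⟩)
  simp only [superLinear_coordVector] at happly
  rw [mul_sub, happly, sub_self]

namespace HasSuperDerivAt

variable {f g : SuperSpace m n → SuperNumber} {f' g' : Fin m ⊕ Fin n → SuperNumber}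
  {x : SuperSpace m n}

theorem unique (hf : HasSuperDerivAt f f' x) (hg : HasSuperDerivAt f g' x) : f' = g' :=
  superLinear_injective ((hasSuperDerivAt_iff.1 hf).unique (hasSuperDerivAt_iff.1 hg))

theorem congr_of_eventuallyEq (hf : HasSuperDerivAt f f' x) (hfg : g =ᶠ[𝓝 x] f) :
    HasSuperDerivAt g f' x :=
  hasSuperDerivAt_iff.2 ((hasSuperDerivAt_iff.1 hf).congr_of_eventuallyEq hfg)

theorem add (hf : HasSuperDerivAt f f' x) (hg : HasSuperDerivAt g g' x) :
    HasSuperDerivAt (fun x => f x + g x) (fun k => f' k + g' k) x := by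
  obtain ⟨L, hL, hfL⟩ := hf
  obtain ⟨N, hN, hgN⟩ := hg
  exact ⟨L + N, fun h => by simp [hL, hN, mul_add, Finset.sum_add_distrib], hfL.add hgN⟩

theorem mul (hf : HasSuperDerivAt f f' x) (hg : HasSuperDerivAt g g' x) {b : ZMod 2}
    (hb : f x ∈ part b) :
    HasSuperDerivAt (fun x => f x * g x)
      (fun k => f' k * g x + koszul (parity k) b • (f x * g' k)) x := by
  obtain ⟨L, hL, hfL⟩ := hf
  obtain ⟨N, hN, hgN⟩ := hg
  refine ⟨_, fun h => ?_, hfL.mul' hgN⟩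
  simp only [_root_.add_apply, _root_.smul_apply, MulOpposite.smul_eq_mul_unop,
    MulOpposite.unop_op, hL, hN, smul_eq_mul, Finset.sum_mul, Finset.mul_sum, mul_add,
    Finset.sum_add_distrib]
  rw [add_comm]
  congr 1
  · simp only [mul_assoc]
  · refine Finset.sum_congr rfl fun k _ => ?_
    rw [← mul_assoc, mul_comm_of_mem hb (h k).2, mul_smul_comm, smul_mul_assoc, mul_assoc,
      koszul_comm]

theorem mem_part (hf : HasSuperDerivAt f f' x) {b : ZMod 2} (hb : ∀ᶠ y in 𝓝 x, f y ∈ part b)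
    (k : Fin m ⊕ Fin n) : f' k ∈ part (parity k + b) := by
  refine mem_part_of_forall_mul fun y hy I hI => ?_
  have hderiv : HasFDerivAt (fun y => coeffCLM I (f y)) ((coeffCLM I).comp (superLinear f')) x :=
    (coeffCLM I).hasFDerivAt.comp x (hasSuperDerivAt_iff.1 hf)
  have hzero : HasFDerivAt (fun y => coeffCLM I (f y)) (0 : SuperSpace m n →L[ℝ] ℝ) x :=
    (hasFDerivAt_const (0 : ℝ) x).congr_of_eventuallyEq (hb.mono fun y hy => hy I hI)
  have happly := DFunLike.congr_fun (hderiv.unique hzero) (coordVector k ⟨y, hy⟩)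
  simpa only [ContinuousLinearMap.comp_apply, superLinear_coordVector, coeffCLM_apply,
    _root_.zero_apply] using happly

end HasSuperDerivAt

theorem hasSuperDerivAt_const (c : SuperNumber) (x : SuperSpace m n) :
    HasSuperDerivAt (fun _ => c) (fun _ => 0) x :=
  ⟨0, by simp, hasFDerivAt_const c x⟩

theorem hasSuperDerivAt_coord (k : Fin m ⊕ Fin n) (x : SuperSpace m n) :
    HasSuperDerivAt (fun y => (y k : SuperNumber)) (Pi.single k 1) x := by
  refine ⟨coordCLM k, fun h => ?_, (coordCLM k).hasFDerivAt⟩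
  rw [Finset.sum_eq_single k]
  · simp [coordCLM]
  · intro j _ hj
    simp [hj]
  · simp

open Classical in
/-- The `k`-th partial derivative of `f`, with the value `0` where `f` is not
superdifferentiable. -/
def superDeriv (k : Fin m ⊕ Fin n) (f : SuperSpace m n → SuperNumber) (x : SuperSpace m n) :
    SuperNumber :=
  if h : ∃ f', HasSuperDerivAt f f' x then h.choose k else 0

theorem HasSuperDerivAt.superDeriv_eq {f : SuperSpace m n → SuperNumber}
    {f' : Fin m ⊕ Fin n → SuperNumber} {x : SuperSpace m n} (h : HasSuperDerivAt f f' x)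
    (k : Fin m ⊕ Fin n) : superDeriv k f x = f' k := by
  have hex : ∃ f', HasSuperDerivAt f f' x := ⟨f', h⟩
  rw [superDeriv, dif_pos hex, hex.choose_spec.unique h]

theorem superDeriv_congr {f g : SuperSpace m n → SuperNumber} {x : SuperSpace m n}
    (hfg : f =ᶠ[𝓝 x] g) (k : Fin m ⊕ Fin n) : superDeriv k f x = superDeriv k g x := by
  have hderiv : (fun f' => HasSuperDerivAt f f' x) = fun f' => HasSuperDerivAt g f' x :=
    funext fun _ => propext
      ⟨fun h => h.congr_of_eventuallyEq hfg.symm, fun h => h.congr_of_eventuallyEq hfg⟩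
  unfold superDeriv
  rw [hderiv]

namespace IsG

variable {U : Set (SuperSpace m n)} {f : SuperSpace m n → SuperNumber} {r : ℕ}

theorem continuousOn : ∀ {r : ℕ}, IsG r f U → ContinuousOn f U
  | 0, h => h
  | _ + 1, h => h.of_succ.continuousOn

theorem congr (hU : IsOpen U) {g : SuperSpace m n → SuperNumber} (hf : IsG r f U)
    (hfg : ∀ x ∈ U, g x = f x) : IsG r g U := by
  cases r with
  | zero => exact ContinuousOn.congr hf hfg
  | succ r =>
    obtain ⟨f', hf', hderiv⟩ := hf
    exact ⟨f', hf', fun x hx => (hderiv x hx).congr_of_eventuallyEq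
      (eventually_of_mem (hU.mem_nhds hx) hfg)⟩

theorem sum {ι : Type*} (s : Finset ι) {f : ι → SuperSpace m n → SuperNumber}
    (hf : ∀ i ∈ s, IsG r (f i) U) : IsG r (fun x => ∑ i ∈ s, f i x) U := by
  classical
  induction s using Finset.induction_on with
  | empty => simpa using isG_const 0 U r
  | insert i s hi ih =>
    simp only [Finset.sum_insert hi]
    exact (hf i (Finset.mem_insert_self i s)).add
      (ih fun j hj => hf j (Finset.mem_insert_of_mem hj))

theorem hasSuperDerivAt (hf : IsG (r + 1) f U) {x : SuperSpace m n} (hx : x ∈ U) :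
    HasSuperDerivAt f (fun k => superDeriv k f x) x := by
  obtain ⟨f', _, hderiv⟩ := hf
  simpa only [(hderiv x hx).superDeriv_eq] using hderiv x hx

theorem superDeriv (hU : IsOpen U) (hf : IsG (r + 1) f U) (k : Fin m ⊕ Fin n) :
    IsG r (superDeriv k f) U := by
  obtain ⟨f', hf', hderiv⟩ := hf
  exact (hf' k).congr hU fun x hx => (hderiv x hx).superDeriv_eq k

end IsG

theorem isG_coord (k : Fin m ⊕ Fin n) (U : Set (SuperSpace m n)) (r : ℕ) :
    IsG r (fun y => (y k : SuperNumber)) U := by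
  cases r with
  | zero => exact (coordCLM k).continuous.continuousOn
  | succ r => exact ⟨fun j _ => (Pi.single k 1 : _ → SuperNumber) j, fun j => isG_const _ U r,
      fun x _ => hasSuperDerivAt_coord k x⟩

theorem continuousOn_of_coords {X : Type*} [TopologicalSpace X] {φ : X → SuperSpace m n}
    {U : Set X} (h : ∀ k, ContinuousOn (fun x => (φ x k : SuperNumber)) U) :
    ContinuousOn φ U :=
  (PiLp.continuous_toLp 1 _).comp_continuousOn <| continuousOn_pi.2 fun k =>
    (Topology.IsInducing.subtypeVal.continuousOn_iff).2 (h k)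

theorem hasFDerivAt_of_coords {φ : SuperSpace m n → SuperSpace m n}
    {φ' : Fin m ⊕ Fin n → Fin m ⊕ Fin n → SuperNumber} {x : SuperSpace m n}
    (h : ∀ k, HasSuperDerivAt (fun y => (φ y k : SuperNumber)) (φ' k) x) :
    ∃ L : SuperSpace m n →L[ℝ] SuperSpace m n, HasFDerivAt φ L x ∧
      ∀ v k, (L v k : SuperNumber) = ∑ l, (v l : SuperNumber) * φ' k l := by
  have hcoord : ∀ k,
      HasFDerivAt (fun y => φ y k) ((proj (parity k)).comp (superLinear (φ' k))) x := fun k =>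
    ((proj (parity k)).hasFDerivAt.comp x (hasSuperDerivAt_iff.1 (h k))).congr_of_eventuallyEq
      (Eventually.of_forall fun y => Subtype.ext (proj_of_mem (φ y k).2).symm)
  have hproj : ∀ k, (part (parity k)).subtypeL.comp ((proj (parity k)).comp (superLinear (φ' k)))
      = superLinear (φ' k) := fun k =>
    ((part (parity k)).subtypeL.hasFDerivAt.comp x (hcoord k)).unique (hasSuperDerivAt_iff.1 (h k))
  refine ⟨_, (PiLp.continuousLinearEquiv 1 ℝ
    (fun k : Fin m ⊕ Fin n => part (parity k))).symm.hasFDerivAt.comp x (hasFDerivAt_pi.2 hcoord),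
    fun v k => ?_⟩
  rw [← superLinear_apply]
  exact DFunLike.congr_fun (hproj k) v

theorem HasSuperDerivAt.comp {F : SuperSpace m n → SuperNumber}
    {φ : SuperSpace m n → SuperSpace m n} {F' : Fin m ⊕ Fin n → SuperNumber}
    {φ' : Fin m ⊕ Fin n → Fin m ⊕ Fin n → SuperNumber} {x : SuperSpace m n}
    (hF : HasSuperDerivAt F F' (φ x))
    (h : ∀ k, HasSuperDerivAt (fun y => (φ y k : SuperNumber)) (φ' k) x) :
    HasSuperDerivAt (fun y => F (φ y)) (fun l => ∑ k, φ' k l * F' k) x := by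
  obtain ⟨L, hL, hL_apply⟩ := hasFDerivAt_of_coords h
  refine ⟨_, fun v => ?_, (hasSuperDerivAt_iff.1 hF).comp x hL⟩
  rw [ContinuousLinearMap.comp_apply, superLinear_apply]
  simp only [hL_apply, Finset.sum_mul, Finset.mul_sum, mul_assoc]
  rw [Finset.sum_comm]

theorem IsG.comp {U W : Set (SuperSpace m n)} {φ : SuperSpace m n → SuperSpace m n}
    (hφ : Set.MapsTo φ U W) : ∀ {r : ℕ} {F : SuperSpace m n → SuperNumber},
      (∀ k, IsG r (fun x => (φ x k : SuperNumber)) U) → IsG r F W → IsG r (fun x => F (φ x)) U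
  | 0, _, h, hF => ContinuousOn.comp hF (continuousOn_of_coords h) hφ
  | r + 1, F, h, ⟨F', hF', hFderiv⟩ => by
    choose φ' hφ' hφderiv using h
    refine ⟨fun l x => ∑ k, φ' k l x * F' k (φ x), fun l => IsG.sum _ fun k _ =>
      (hφ' k l).mul (IsG.comp hφ (fun k => IsG.of_succ ⟨φ' k, hφ' k, hφderiv k⟩) (hF' k)),
      fun x hx => ?_⟩
    exact (hFderiv _ (hφ hx)).comp fun k => hφderiv k x hx

theorem HasSuperDerivAt.ringInverse {f : SuperSpace m n → SuperNumber}
    {f' : Fin m ⊕ Fin n → SuperNumber} {x : SuperSpace m n} (hf : HasSuperDerivAt f f' x)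
    (hunit : IsUnit (f x)) (heven : Ring.inverse (f x) ∈ part 0) :
    HasSuperDerivAt (fun y => Ring.inverse (f y))
      (fun k => (-1 : ℝ) • (Ring.inverse (f x) * f' k * Ring.inverse (f x))) x := by
  obtain ⟨u, hu⟩ := hunit
  have hinv := hasFDerivAt_ringInverse (𝕜 := ℝ) u
  rw [← Ring.inverse_unit, hu] at hinv
  refine ⟨_, fun h => ?_, hinv.comp x (hasSuperDerivAt_iff.1 hf)⟩
  simp only [ContinuousLinearMap.comp_apply, superLinear_apply, _root_.neg_apply,
    ContinuousLinearMap.mulLeftRight_apply, Finset.mul_sum, Finset.sum_mul]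
  rw [← Finset.sum_neg_distrib]
  refine Finset.sum_congr rfl fun k _ => ?_
  rw [← mul_assoc, ← mul_comm_even _ heven]
  simp [mul_assoc]

theorem IsG.ringInverse {U : Set (SuperSpace m n)} : ∀ {r : ℕ} {f : SuperSpace m n → SuperNumber},
    IsG r f U → (∀ x ∈ U, IsUnit (f x) ∧ Ring.inverse (f x) ∈ part 0) →
      IsG r (fun x => Ring.inverse (f x)) U
  | 0, f, hf, hu => fun x hx => by
    obtain ⟨u, hu⟩ := (hu x hx).1
    have hinv := NormedRing.inverse_continuousAt u
    rw [hu] at hinv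
    exact hinv.comp_continuousWithinAt (hf x hx)
  | r + 1, f, hf, hu => by
    have hinv := hf.of_succ.ringInverse hu
    obtain ⟨f', hf', hderiv⟩ := hf
    exact ⟨fun k x => (-1 : ℝ) • (Ring.inverse (f x) * f' k x * Ring.inverse (f x)),
      fun k => isG_const_smul _ ((hinv.mul (hf' k)).mul hinv), fun x hx =>
        (hderiv x hx).ringInverse (hu x hx).1 (hu x hx).2⟩

end Calculus

section Segment

open MeasureTheory

/-- The weighted average `∫ t in 0..1, t ^ j • f (x₀ + t • (x - x₀))` of `f` over the segment from
`x₀` to `x`. Differentiation in `x` raises the weight `j` by one; this is why all weights occur. -/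
def segmentAverage {H E : Type*} [NormedAddCommGroup H] [NormedSpace ℝ H] [NormedAddCommGroup E]
    [NormedSpace ℝ E] (x₀ : H) (j : ℕ) (f : H → E) (x : H) : E :=
  ∫ t in (0 : ℝ)..1, t ^ j • f (x₀ + t • (x - x₀))

variable {H E : Type*} [NormedAddCommGroup H] [NormedSpace ℝ H] {x₀ x : H} {ρ : ℝ}

theorem segment_mem_ball (hx : x ∈ Metric.ball x₀ ρ) {t : ℝ} (ht : t ∈ Set.Icc (0 : ℝ) 1) :
    x₀ + t • (x - x₀) ∈ Metric.ball x₀ ρ :=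
  (convex_ball x₀ ρ).add_smul_sub_mem
    (Metric.mem_ball_self (dist_nonneg.trans_lt (Metric.mem_ball.1 hx))) hx ht

theorem continuousOn_segment [TopologicalSpace E] {f : H → E}
    (hf : ContinuousOn f (Metric.ball x₀ ρ)) (hx : x ∈ Metric.ball x₀ ρ) :
    ContinuousOn (fun t : ℝ => f (x₀ + t • (x - x₀))) (Set.uIcc 0 1) := by
  rw [Set.uIcc_of_le zero_le_one]
  exact hf.comp (by fun_prop) fun _ ht => segment_mem_ball hx ht

theorem eventually_segment_le {f : H → ℝ} (hf : ContinuousOn f (Metric.ball x₀ ρ))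
    (hx : x ∈ Metric.ball x₀ ρ) :
    ∃ C, ∀ᶠ y in 𝓝 x, ∀ t ∈ Set.Icc (0 : ℝ) 1, f (x₀ + t • (y - x₀)) ≤ C := by
  obtain ⟨C, hC⟩ := isCompact_uIcc.exists_bound_of_continuousOn (continuousOn_segment hf hx)
  rw [Set.uIcc_of_le zero_le_one] at hC
  refine ⟨C + 1, isCompact_Icc.eventually_forall_of_forall_eventually fun t ht => ?_⟩
  have hseg : ContinuousAt (fun z : H × ℝ => x₀ + z.2 • (z.1 - x₀)) (x, t) := by fun_prop
  have hcomp : ContinuousAt (fun z : H × ℝ => f (x₀ + z.2 • (z.1 - x₀))) (x, t) :=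
    ContinuousAt.comp (f := fun z : H × ℝ => x₀ + z.2 • (z.1 - x₀))
      (hf.continuousAt (Metric.isOpen_ball.mem_nhds (segment_mem_ball hx ht))) hseg
  have hlt : f (x₀ + t • (x - x₀)) < C + 1 :=
    ((le_abs_self _).trans (hC t ht)).trans_lt (lt_add_one C)
  exact (hcomp.eventually_lt_const hlt).mono fun _ hz => hz.le

variable [NormedAddCommGroup E] [NormedSpace ℝ E]

theorem continuousOn_weighted_segment {f : H → E} (hf : ContinuousOn f (Metric.ball x₀ ρ)) (j : ℕ)
    (hx : x ∈ Metric.ball x₀ ρ) :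
    ContinuousOn (fun t : ℝ => t ^ j • f (x₀ + t • (x - x₀))) (Set.uIcc 0 1) :=
  (continuous_pow j).continuousOn.smul (continuousOn_segment hf hx)

theorem aestronglyMeasurable_weighted_segment {f : H → E} (hf : ContinuousOn f (Metric.ball x₀ ρ))
    (j : ℕ) (hx : x ∈ Metric.ball x₀ ρ) :
    AEStronglyMeasurable (fun t : ℝ => t ^ j • f (x₀ + t • (x - x₀)))
      (volume.restrict (Set.uIoc 0 1)) :=
  ((continuousOn_weighted_segment hf j hx).mono Set.uIoc_subset_uIcc).aestronglyMeasurable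
    measurableSet_uIoc

theorem hasFDerivAt_weighted_segment (j : ℕ) {t : ℝ} {f : H → E} {f' : H →L[ℝ] E}
    (hf : HasFDerivAt f f' (x₀ + t • (x - x₀))) :
    HasFDerivAt (fun y => t ^ j • f (x₀ + t • (y - x₀))) (t ^ (j + 1) • f') x := by
  have hseg : HasFDerivAt (fun y : H => x₀ + t • (y - x₀)) (t • ContinuousLinearMap.id ℝ H) x :=
    (((hasFDerivAt_id x).sub_const x₀).const_smul t).const_add x₀
  have hchain := (hf.comp x hseg).const_smul (t ^ j)
  rwa [ContinuousLinearMap.comp_smul, ContinuousLinearMap.comp_id, smul_smul, ← pow_succ] at hchain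

theorem hasFDerivAt_segmentAverage (j : ℕ) {f : H → E} {f' : H → H →L[ℝ] E}
    (hf' : ContinuousOn f' (Metric.ball x₀ ρ)) (hf : ∀ y ∈ Metric.ball x₀ ρ, HasFDerivAt f (f' y) y)
    (hx : x ∈ Metric.ball x₀ ρ) :
    HasFDerivAt (segmentAverage x₀ j f) (segmentAverage x₀ (j + 1) f' x) x := by
  have hfc : ContinuousOn f (Metric.ball x₀ ρ) := fun y hy =>
    (hf y hy).continuousAt.continuousWithinAt
  obtain ⟨C, hC⟩ := eventually_segment_le hf'.norm hx
  have hball : Metric.ball x₀ ρ ∈ 𝓝 x := Metric.isOpen_ball.mem_nhds hx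
  have hIcc : ∀ t ∈ Set.uIoc (0 : ℝ) 1, t ∈ Set.Icc (0 : ℝ) 1 := fun t ht =>
    Set.uIcc_of_le (zero_le_one (α := ℝ)) ▸ Set.uIoc_subset_uIcc ht
  refine intervalIntegral.hasFDerivAt_integral_of_dominated_of_fderiv_le (bound := fun _ => C)
    (inter_mem hC hball)
    (eventually_of_mem hball fun y hy => aestronglyMeasurable_weighted_segment hfc j hy)
    (continuousOn_weighted_segment hfc j hx).intervalIntegrable
    (aestronglyMeasurable_weighted_segment hf' (j + 1) hx)
    (Eventually.of_forall fun t ht y hy => ?_) intervalIntegrable_const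
    (Eventually.of_forall fun t ht y hy =>
      hasFDerivAt_weighted_segment j (hf _ (segment_mem_ball hy.2 (hIcc t ht))))
  obtain ⟨ht0, ht1⟩ := hIcc t ht
  rw [norm_smul, norm_pow, Real.norm_of_nonneg ht0]
  exact (mul_le_of_le_one_left (norm_nonneg _) (pow_le_one₀ ht0 ht1)).trans (hy.1 t ⟨ht0, ht1⟩)

theorem segmentAverage_apply {F : Type*} [NormedAddCommGroup F] [NormedSpace ℝ F] (j : ℕ)
    {f : H → F →L[ℝ] E} (hf : ContinuousOn f (Metric.ball x₀ ρ)) (hx : x ∈ Metric.ball x₀ ρ)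
    (v : F) : segmentAverage x₀ j f x v = segmentAverage x₀ j (fun y => f y v) x :=
  ContinuousLinearMap.intervalIntegral_apply
    (continuousOn_weighted_segment hf j hx).intervalIntegrable v

end Segment

section Hadamard

variable {m n : ℕ} {x₀ x : SuperSpace m n} {ρ : ℝ}

theorem superLinear_segmentAverage (j : ℕ) {f : Fin m ⊕ Fin n → SuperSpace m n → SuperNumber}
    (hf : ∀ k, ContinuousOn (f k) (Metric.ball x₀ ρ)) (hx : x ∈ Metric.ball x₀ ρ) :
    superLinear (fun k => segmentAverage x₀ j (f k) x)
      = segmentAverage x₀ j (fun y => superLinear fun k => f k y) x := by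
  ext1 v
  have hsuper : ContinuousOn (fun y => superLinear fun k => f k y) (Metric.ball x₀ ρ) :=
    continuous_superLinear.comp_continuousOn (continuousOn_pi.2 hf)
  rw [segmentAverage_apply j hsuper hx, superLinear_apply]
  simp only [segmentAverage, superLinear_apply, Finset.smul_sum]
  rw [intervalIntegral.integral_finsetSum fun k _ => (continuousOn_weighted_segment
    (f := fun y => (v k : SuperNumber) * f k y)
    (continuousOn_const.mul (hf k)) j hx).intervalIntegrable]
  refine Finset.sum_congr rfl fun k _ => ?_
  simp only [← mul_smul_comm]
  exact ((ContinuousLinearMap.mul ℝ SuperNumber (v k)).intervalIntegral_comp_comm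
    (continuousOn_weighted_segment (hf k) j hx).intervalIntegrable).symm

theorem hasSuperDerivAt_segmentAverage (j : ℕ) {f : SuperSpace m n → SuperNumber}
    {f' : Fin m ⊕ Fin n → SuperSpace m n → SuperNumber}
    (hf' : ∀ k, ContinuousOn (f' k) (Metric.ball x₀ ρ))
    (hf : ∀ y ∈ Metric.ball x₀ ρ, HasSuperDerivAt f (fun k => f' k y) y)
    (hx : x ∈ Metric.ball x₀ ρ) :
    HasSuperDerivAt (segmentAverage x₀ j f) (fun k => segmentAverage x₀ (j + 1) (f' k) x) x := by
  rw [hasSuperDerivAt_iff, superLinear_segmentAverage _ hf' hx]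
  exact hasFDerivAt_segmentAverage j
    (continuous_superLinear.comp_continuousOn (continuousOn_pi.2 hf'))
    (fun y hy => hasSuperDerivAt_iff.1 (hf y hy)) hx

theorem isG_segmentAverage : ∀ {r : ℕ} {f : SuperSpace m n → SuperNumber} (j : ℕ),
    IsG (r + 1) f (Metric.ball x₀ ρ) → IsG r (segmentAverage x₀ j f) (Metric.ball x₀ ρ)
  | 0, _, j, ⟨_, hf', hf⟩ => fun _ hx =>
    (hasSuperDerivAt_iff.1 (hasSuperDerivAt_segmentAverage j (fun k => (hf' k).continuousOn) hf
      hx)).continuousAt.continuousWithinAt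
  | _ + 1, _, j, ⟨f', hf', hf⟩ =>
    ⟨fun k => segmentAverage x₀ (j + 1) (f' k),
      fun k => isG_segmentAverage (j + 1) (hf' k), fun _ hx =>
        hasSuperDerivAt_segmentAverage j (fun k => (hf' k).continuousOn) hf hx⟩

theorem hasDerivAt_along_segment {f : SuperSpace m n → SuperNumber}
    {f' : Fin m ⊕ Fin n → SuperNumber} {t : ℝ} (hf : HasSuperDerivAt f f' (x₀ + t • (x - x₀))) :
    HasDerivAt (fun t : ℝ => f (x₀ + t • (x - x₀))) (∑ k, ((x - x₀) k : SuperNumber) * f' k) t := by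
  have hseg : HasDerivAt (fun t : ℝ => x₀ + t • (x - x₀)) (x - x₀) t := by
    simpa using ((hasDerivAt_id t).smul_const (x - x₀)).const_add x₀
  rw [← superLinear_apply]
  exact (hasSuperDerivAt_iff.1 hf).comp_hasDerivAt t hseg

theorem sub_eq_sum_mul_segmentAverage {f : SuperSpace m n → SuperNumber}
    (hf : IsG 1 f (Metric.ball x₀ ρ)) (hx : x ∈ Metric.ball x₀ ρ) :
    f x - f x₀ = ∑ k, ((x - x₀) k : SuperNumber)
      * segmentAverage x₀ 0 (superDeriv k f) x := by
  have hcont : ∀ k, ContinuousOn (fun t : ℝ => superDeriv k f (x₀ + t • (x - x₀))) (Set.uIcc 0 1) :=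
    fun k => continuousOn_segment (hf.superDeriv (r := 0) Metric.isOpen_ball k) hx
  have hterm : ∀ k, ContinuousOn
      (fun t : ℝ => ((x - x₀) k : SuperNumber) * superDeriv k f (x₀ + t • (x - x₀)))
      (Set.uIcc 0 1) := fun k => continuousOn_const.mul (hcont k)
  have hderiv : ∀ t ∈ Set.uIcc (0 : ℝ) 1, HasDerivAt (fun t : ℝ => f (x₀ + t • (x - x₀)))
      (∑ k, ((x - x₀) k : SuperNumber) * superDeriv k f (x₀ + t • (x - x₀))) t := fun t ht =>
    hasDerivAt_along_segment (hf.hasSuperDerivAt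
      (segment_mem_ball hx (Set.uIcc_of_le (zero_le_one (α := ℝ)) ▸ ht)))
  have hftc := intervalIntegral.integral_eq_sub_of_hasDerivAt hderiv
    (continuousOn_finsetSum _ fun k _ => hterm k).intervalIntegrable
  rw [intervalIntegral.integral_finsetSum fun k _ => (hterm k).intervalIntegrable] at hftc
  simp only [one_smul, zero_smul, add_zero, add_sub_cancel] at hftc
  rw [← hftc]
  refine Finset.sum_congr rfl fun k _ => ?_
  simp only [segmentAverage, pow_zero, one_smul]
  exact (ContinuousLinearMap.mul ℝ SuperNumber ((x - x₀) k)).intervalIntegral_comp_comm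
    (hcont k).intervalIntegrable

theorem IsGInfty.hadamard {f : SuperSpace m n → SuperNumber} (hf : IsGInfty f (Metric.ball x₀ ρ)) :
    ∃ F : Fin m ⊕ Fin n → SuperSpace m n → SuperNumber,
      (∀ k, IsGInfty (F k) (Metric.ball x₀ ρ)) ∧ ∀ x ∈ Metric.ball x₀ ρ,
        f x = f x₀ + ∑ k, ((x k : SuperNumber) - (x₀ k : SuperNumber)) * F k x :=
  ⟨fun k => segmentAverage x₀ 0 (superDeriv k f),
    fun k r => isG_segmentAverage 0 (IsG.superDeriv Metric.isOpen_ball (hf (r + 2)) k),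
    fun _ hx => sub_eq_iff_eq_add'.1 (sub_eq_sum_mul_segmentAverage (hf 1) hx)⟩

end Hadamard

section Manifold

variable {m n : ℕ} {M : Type*} [TopologicalSpace M] [ChartedSpace (SuperSpace m n) M]

namespace IsGInftyOn

variable {f g : M → SuperNumber} {U V : Set M}

theorem mono (hf : IsGInftyOn m n f U) (hVU : V ⊆ U) : IsGInftyOn m n f V := fun e he r =>
  (hf e he r).mono (Set.inter_subset_inter_right _ (Set.preimage_mono hVU))

theorem isGInftyAt (hf : IsGInftyOn m n f U) (hU : IsOpen U) {p : M} (hp : p ∈ U) :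
    IsGInftyAt m n f p :=
  ⟨U, hU, hp, hf⟩

theorem congr (hf : IsGInftyOn m n f U) (hU : IsOpen U) (hfg : ∀ q ∈ U, g q = f q) :
    IsGInftyOn m n g U := fun e he r =>
  (hf e he r).congr (e.symm.isOpen_inter_preimage hU) fun _ hx => hfg _ hx.2

theorem const (c : SuperNumber) (U : Set M) : IsGInftyOn m n (fun _ => c) U :=
  fun _ _ r => isG_const c _ r

theorem add (hf : IsGInftyOn m n f U) (hg : IsGInftyOn m n g U) :
    IsGInftyOn m n (fun q => f q + g q) U :=
  fun e he r => (hf e he r).add (hg e he r)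

theorem mul (hf : IsGInftyOn m n f U) (hg : IsGInftyOn m n g U) :
    IsGInftyOn m n (fun q => f q * g q) U :=
  fun e he r => (hf e he r).mul (hg e he r)

theorem neg (hf : IsGInftyOn m n f U) : IsGInftyOn m n (fun q => -f q) U := by
  simpa using (IsGInftyOn.const (-1) U).mul hf

theorem ringInverse (hf : IsGInftyOn m n f U)
    (hu : ∀ q ∈ U, IsUnit (f q) ∧ Ring.inverse (f q) ∈ part 0) :
    IsGInftyOn m n (fun q => Ring.inverse (f q)) U :=
  fun e he r => (hf e he r).ringInverse fun _ hx => hu _ hx.2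

theorem continuousOn (hf : IsGInftyOn m n f U) (hU : IsOpen U) : ContinuousOn f U := by
  refine hU.continuousOn_iff.2 fun q hq => ?_
  let e := chartAt (SuperSpace m n) q
  have hqe : q ∈ e.source := mem_chart_source _ q
  have hchart : ContinuousAt (fun x => f (e.symm x)) (e q) :=
    (hf e (chart_mem_atlas _ q) 0).continuousOn.continuousAt
      ((e.symm.isOpen_inter_preimage hU).mem_nhds
        ⟨e.map_source hqe, by simpa [e.left_inv hqe] using hq⟩)
  refine (hchart.comp (f := e) (e.continuousAt hqe)).congr ?_
  filter_upwards [e.open_source.mem_nhds hqe] with x hx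
  simp [e.left_inv hx]

end IsGInftyOn

section Chart

variable {e : OpenPartialHomeomorph M (SuperSpace m n)}

theorem isGInftyOn_comp_chart [IsSuperManifold m n M] (he : e ∈ atlas (SuperSpace m n) M)
    {F : SuperSpace m n → SuperNumber} {W : Set (SuperSpace m n)} (hF : IsGInfty F W) :
    IsGInftyOn m n (fun q => F (e q)) (e.source ∩ e ⁻¹' W) := fun e' he' r => by
  refine IsG.comp (φ := fun x => e (e'.symm x)) (W := W) (fun x hx => hx.2.2) (fun k => ?_) (hF r)
  refine (IsSuperManifold.compatible e' he' e he k r).mono fun x hx => ?_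
  rw [OpenPartialHomeomorph.trans_source]
  exact ⟨hx.1, hx.2.1⟩

theorem isGInftyOn_coord [IsSuperManifold m n M] (he : e ∈ atlas (SuperSpace m n) M)
    (k : Fin m ⊕ Fin n) : IsGInftyOn m n (fun q => (e q k : SuperNumber)) e.source := by
  simpa using isGInftyOn_comp_chart he (W := Set.univ) fun r => isG_coord k _ r

theorem IsGInftyAt.hasSuperDerivAt {f : M → SuperNumber} {q : M} (hf : IsGInftyAt m n f q)
    (he : e ∈ atlas (SuperSpace m n) M) (hq : q ∈ e.source) :
    HasSuperDerivAt (fun x => f (e.symm x))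
      (fun k => superDeriv k (fun x => f (e.symm x)) (e q)) (e q) := by
  obtain ⟨U, -, hqU, hf⟩ := hf
  exact (hf e he 1).hasSuperDerivAt ⟨e.map_source hq, by simpa [e.left_inv hq] using hqU⟩

end Chart

/-- The germ at `q` of a function of class `G^∞` near `q`. -/
def germMk {f : M → SuperNumber} {q : M} (hf : IsGInftyAt m n f q) : SmoothGerm m n q :=
  ⟨(f : Germ (𝓝 q) SuperNumber), f, hf, rfl⟩

theorem exists_eq_germMk {q : M} (F : SmoothGerm m n q) :
    ∃ (f : M → SuperNumber) (hf : IsGInftyAt m n f q), F = germMk hf := by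
  obtain ⟨_, f, hf, rfl⟩ := F
  exact ⟨f, hf, rfl⟩

theorem germMk_add {q : M} {f g : M → SuperNumber} (hf : IsGInftyAt m n f q)
    (hg : IsGInftyAt m n g q) : germMk hf + germMk hg =
      germMk (hf.map₂ (· + ·) (fun _ _ _ _ hF hG => hF.add hG) hg) := rfl

theorem germMk_mul {q : M} {f g : M → SuperNumber} (hf : IsGInftyAt m n f q)
    (hg : IsGInftyAt m n g q) : germMk hf * germMk hg =
      germMk (hf.map₂ (· * ·) (fun _ _ _ _ hF hG => hF.mul hG) hg) := rfl

theorem constGerm_eq_germMk (q : M) (c : SuperNumber) :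
    constGerm m n q c = germMk (isGInftyAt_const m n c q) := rfl

theorem value_mem_part {q : M} {b : ZMod 2} {F : SmoothGerm m n q}
    (hF : (F : Germ (𝓝 q) SuperNumber).LiftPred (· ∈ part b)) :
    (F : Germ (𝓝 q) SuperNumber).value ∈ part b := by
  obtain ⟨f, hf, rfl⟩ := exists_eq_germMk F
  exact (Germ.liftPred_coe.1 hF).self_of_nhds

/-- The derivation `∂/∂x^k` at `q` in the coordinates of the chart `e`. It differentiates an
arbitrary representative of the germ. -/
def coordDeriv (e : OpenPartialHomeomorph M (SuperSpace m n)) (k : Fin m ⊕ Fin n) (q : M)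
    (F : SmoothGerm m n q) : SuperNumber :=
  superDeriv k (fun x => F.2.choose (e.symm x)) (e q)

section CoordDeriv

variable {e : OpenPartialHomeomorph M (SuperSpace m n)} {q : M}

theorem coordDeriv_germMk (hq : q ∈ e.source) (k : Fin m ⊕ Fin n) {f : M → SuperNumber}
    (hf : IsGInftyAt m n f q) :
    coordDeriv e k q (germMk hf) = superDeriv k (fun x => f (e.symm x)) (e q) :=
  superDeriv_congr
    ((e.tendsto_symm hq).eventually (Germ.coe_eq.1 (germMk hf).2.choose_spec.2)) k

theorem isHomogeneousVector_coordDeriv (he : e ∈ atlas (SuperSpace m n) M) (hq : q ∈ e.source)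
    (k : Fin m ⊕ Fin n) : IsHomogeneousVector m n q (parity k) (coordDeriv e k q) where
  map_add F G := by
    obtain ⟨f, hf, rfl⟩ := exists_eq_germMk F
    obtain ⟨g, hg, rfl⟩ := exists_eq_germMk G
    simp only [germMk_add, coordDeriv_germMk hq]
    exact ((hf.hasSuperDerivAt he hq).add (hg.hasSuperDerivAt he hq)).superDeriv_eq k
  map_const_mul b c hc F := by
    obtain ⟨f, hf, rfl⟩ := exists_eq_germMk F
    simp only [constGerm_eq_germMk, germMk_mul, coordDeriv_germMk hq]
    simpa using
      ((hasSuperDerivAt_const c (e q)).mul (hf.hasSuperDerivAt he hq) hc).superDeriv_eq k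
  leibniz b F G hF := by
    have hF_value := value_mem_part hF
    obtain ⟨f, hf, rfl⟩ := exists_eq_germMk F
    obtain ⟨g, hg, rfl⟩ := exists_eq_germMk G
    simp only [germMk_mul, coordDeriv_germMk hq]
    have hmul := ((hf.hasSuperDerivAt he hq).mul (hg.hasSuperDerivAt he hq) (b := b)
      (by rw [e.left_inv hq]; exact hF_value)).superDeriv_eq k
    simp only [e.left_inv hq] at hmul
    exact hmul
  map_parity b F hF := by
    obtain ⟨f, hf, rfl⟩ := exists_eq_germMk F
    rw [coordDeriv_germMk hq]
    exact (hf.hasSuperDerivAt he hq).mem_part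
      ((e.tendsto_symm hq).eventually (Germ.liftPred_coe.1 hF)) k

/-- The germ at `q` of the `k`-th coordinate of the chart `e`. -/
def coordGerm [IsSuperManifold m n M] (he : e ∈ atlas (SuperSpace m n) M) (hq : q ∈ e.source)
    (k : Fin m ⊕ Fin n) : SmoothGerm m n q :=
  germMk ((isGInftyOn_coord he k).isGInftyAt e.open_source hq)

theorem coordDeriv_coordGerm [IsSuperManifold m n M] (he : e ∈ atlas (SuperSpace m n) M)
    (hq : q ∈ e.source) (j k : Fin m ⊕ Fin n) :
    coordDeriv e j q (coordGerm he hq k) = (Pi.single k 1 : _ → SuperNumber) j := by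
  have hinv : (fun x => (e (e.symm x) k : SuperNumber)) =ᶠ[𝓝 (e q)] fun x => x k := by
    filter_upwards [e.open_target.mem_nhds (e.map_source hq)] with x hx
    rw [e.right_inv hx]
  rw [coordGerm, coordDeriv_germMk hq, superDeriv_congr hinv,
    (hasSuperDerivAt_coord k (e q)).superDeriv_eq]

theorem coe_germ_sum {X R ι : Type*} [AddCommMonoid R] (l : Filter X) (s : Finset ι)
    (f : ι → X → R) :
    ((fun x => ∑ i ∈ s, f i x : X → R) : Germ l R) = ∑ i ∈ s, (f i : Germ l R) := by
  rw [← Finset.sum_fn]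
  exact map_sum (Germ.coeAddHom (M := R) l) f s

theorem exists_germ_expansion [IsSuperManifold m n M] (he : e ∈ atlas (SuperSpace m n) M)
    (hq : q ∈ e.source) (F : SmoothGerm m n q) :
    ∃ (c : SuperNumber) (G : Fin m ⊕ Fin n → SmoothGerm m n q), F = constGerm m n q c
      + ∑ k, (coordGerm he hq k - constGerm m n q (e q k)) * G k := by
  obtain ⟨f, ⟨U, hU, hqU, hf⟩, rfl⟩ := exists_eq_germMk F
  obtain ⟨ρ, hρ, hball⟩ := Metric.isOpen_iff.1 (e.symm.isOpen_inter_preimage hU) (e q)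
    ⟨e.map_source hq, by simpa [e.left_inv hq] using hqU⟩
  have hf_ball : IsGInfty (fun x => f (e.symm x)) (Metric.ball (e q) ρ) :=
    fun r => (hf e he r).mono hball
  obtain ⟨Φ, hΦ, hexpand⟩ := hf_ball.hadamard
  have hN : IsOpen (e.source ∩ e ⁻¹' Metric.ball (e q) ρ) :=
    e.isOpen_inter_preimage Metric.isOpen_ball
  have hqN : q ∈ e.source ∩ e ⁻¹' Metric.ball (e q) ρ := ⟨hq, Metric.mem_ball_self hρ⟩
  have hG : ∀ k, IsGInftyAt m n (fun x => Φ k (e x)) q := fun k =>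
    (isGInftyOn_comp_chart he (hΦ k)).isGInftyAt hN hqN
  refine ⟨f q, fun k => germMk (hG k), Subtype.ext ?_⟩
  rw [Subring.coe_add, AddSubmonoidClass.coe_finsetSum]
  have hsum := coe_germ_sum (𝓝 q) Finset.univ
    fun k x => ((e x k : SuperNumber) - e q k) * Φ k (e x)
  refine Eq.trans ?_ (congrArg ((constGerm m n q (f q) : Germ (𝓝 q) SuperNumber) + ·) hsum)
  refine Germ.coe_eq.2 (eventually_of_mem (hN.mem_nhds hqN) fun x hx => ?_)
  simpa only [e.left_inv hx.1, e.left_inv hq] using hexpand (e x) hx.2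

end CoordDeriv

namespace IsHomogeneousVector

variable {p : M} {a : ZMod 2} {X : SmoothGerm m n p → SuperNumber}

theorem map_sub (hX : IsHomogeneousVector m n p a X) (F G : SmoothGerm m n p) :
    X (F - G) = X F - X G :=
  _root_.map_sub (AddMonoidHom.mk' X hX.map_add) F G

theorem map_sum (hX : IsHomogeneousVector m n p a X) {ι : Type*} (s : Finset ι)
    (F : ι → SmoothGerm m n p) : X (∑ i ∈ s, F i) = ∑ i ∈ s, X (F i) :=
  _root_.map_sum (AddMonoidHom.mk' X hX.map_add) F s

theorem map_one (hX : IsHomogeneousVector m n p a X) : X 1 = 0 := by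
  have hvalue : ((1 : SmoothGerm m n p) : Germ (𝓝 p) SuperNumber).value = 1 := rfl
  have h := hX.leibniz 0 1 1
    (Germ.liftPred_coe.2 (Eventually.of_forall fun _ => one_mem_part))
  rw [koszul_zero_right, one_smul, mul_one, hvalue, mul_one, one_mul] at h
  exact left_eq_add.1 h

theorem map_const (hX : IsHomogeneousVector m n p a X) (c : SuperNumber) :
    X (constGerm m n p c) = 0 := by
  have hpure : ∀ b, ∀ c ∈ part b, X (constGerm m n p c) = 0 := fun b c hc => by
    simpa [hX.map_one] using hX.map_const_mul b c hc 1
  have hsplit : constGerm m n p c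
      = constGerm m n p (proj 0 c : SuperNumber) + constGerm m n p (proj 1 c : SuperNumber) := by
    conv_lhs => rw [← proj_add_proj c]
    rfl
  rw [hsplit, hX.map_add, hpure 0 _ (proj 0 c).2, hpure 1 _ (proj 1 c).2, add_zero]

theorem map_coordGerm_sub_mul [IsSuperManifold m n M] (hX : IsHomogeneousVector m n p a X)
    {e : OpenPartialHomeomorph M (SuperSpace m n)} (he : e ∈ atlas (SuperSpace m n) M)
    (hp : p ∈ e.source) (k : Fin m ⊕ Fin n) (G : SmoothGerm m n p) :
    X ((coordGerm he hp k - constGerm m n p (e p k)) * G)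
      = X (coordGerm he hp k) * (G : Germ (𝓝 p) SuperNumber).value := by
  have hparity : ((coordGerm he hp k - constGerm m n p (e p k) : SmoothGerm m n p) :
      Germ (𝓝 p) SuperNumber).LiftPred (· ∈ part (parity k)) :=
    Germ.liftPred_coe.2 (Eventually.of_forall fun x => sub_mem (e x k).2 (e p k).2)
  have hvalue : ((coordGerm he hp k - constGerm m n p (e p k) : SmoothGerm m n p) :
      Germ (𝓝 p) SuperNumber).value = 0 := sub_self (e p k : SuperNumber)
  rw [hX.leibniz _ _ _ hparity, hvalue, zero_mul, smul_zero, add_zero, hX.map_sub, hX.map_const,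
    sub_zero]

end IsHomogeneousVector

section CoordField

variable {e : OpenPartialHomeomorph M (SuperSpace m n)} {q : M}

theorem exists_value_expansion [IsSuperManifold m n M] (he : e ∈ atlas (SuperSpace m n) M)
    (hq : q ∈ e.source) (F : SmoothGerm m n q) : ∃ c : Fin m ⊕ Fin n → SuperNumber,
      ∀ a X, IsHomogeneousVector m n q a X → X F = ∑ k, X (coordGerm he hq k) * c k := by
  obtain ⟨c, G, rfl⟩ := exists_germ_expansion he hq F
  refine ⟨fun k => (G k : Germ (𝓝 q) SuperNumber).value, fun a X hX => ?_⟩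
  rw [hX.map_add, hX.map_const, zero_add, hX.map_sum]
  exact Finset.sum_congr rfl fun k _ => hX.map_coordGerm_sub_mul he hq k (G k)

theorem tangent_apply_eq_sum [IsSuperManifold m n M] (he : e ∈ atlas (SuperSpace m n) M)
    (hq : q ∈ e.source) (X : SuperTangent m n q) (F : SmoothGerm m n q) :
    X.1 F = ∑ k, X.1 (coordGerm he hq k) * coordDeriv e k q F := by
  obtain ⟨c, hc⟩ := exists_value_expansion he hq F
  have hcoeff : ∀ k, coordDeriv e k q F = c k := fun k => by
    rw [hc _ _ (isHomogeneousVector_coordDeriv he hq k)]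
    simp [coordDeriv_coordGerm, Pi.single_apply]
  simp only [hcoeff]
  refine Submodule.span_induction (p := fun X _ => X F = ∑ k, X (coordGerm he hq k) * c k)
    ?_ ?_ ?_ ?_ X.2
  · rintro X ⟨a, hX⟩
    exact hc a X hX
  · simp
  · intro X Y _ _ hX hY
    simp only [Pi.add_apply, hX, hY, add_mul, Finset.sum_add_distrib]
  · intro a X _ hX
    simp only [Pi.smul_apply, smul_eq_mul, hX, Finset.mul_sum, mul_assoc]

open Classical in
/-- The coordinate vector field `∂/∂x^k` of the chart `e`, with the junk value `0` at the points
where `coordDeriv e k q` is not a tangent vector (such points lie outside the domain of `e`). -/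
def coordField (e : OpenPartialHomeomorph M (SuperSpace m n)) (k : Fin m ⊕ Fin n) (q : M) :
    SuperTangent m n q :=
  if h : coordDeriv e k q ∈ SuperTangent m n q then ⟨coordDeriv e k q, h⟩ else 0

theorem coe_coordField (he : e ∈ atlas (SuperSpace m n) M) (hq : q ∈ e.source)
    (k : Fin m ⊕ Fin n) :
    (coordField e k q : SmoothGerm m n q → SuperNumber) = coordDeriv e k q := by
  have hmem : coordDeriv e k q ∈ SuperTangent m n q :=
    Submodule.subset_span ⟨_, isHomogeneousVector_coordDeriv he hq k⟩
  rw [coordField, dif_pos hmem]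

theorem isPure_coordField (he : e ∈ atlas (SuperSpace m n) M) (hq : q ∈ e.source)
    (k : Fin m ⊕ Fin n) : IsPure (parity k) (coordField e k q) := by
  rw [IsPure, coe_coordField he hq]
  exact isHomogeneousVector_coordDeriv he hq k

theorem eq_sum_smul_coordField [IsSuperManifold m n M] (he : e ∈ atlas (SuperSpace m n) M)
    (hq : q ∈ e.source) (X : SuperTangent m n q) :
    X = ∑ k, X.1 (coordGerm he hq k) • coordField e k q := by
  refine Subtype.ext (funext fun F => ?_)
  rw [tangent_apply_eq_sum he hq X F, AddSubmonoidClass.coe_finsetSum, Finset.sum_apply]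
  refine Finset.sum_congr rfl fun k _ => ?_
  rw [Submodule.coe_smul, coe_coordField he hq]
  rfl

theorem span_coordField [IsSuperManifold m n M] (he : e ∈ atlas (SuperSpace m n) M)
    (hq : q ∈ e.source) :
    Submodule.span SuperNumber (Set.range fun k => coordField (m := m) (n := n) e k q) = ⊤ :=
  eq_top_iff.2 fun X _ => by
    rw [eq_sum_smul_coordField he hq X]
    exact Submodule.sum_mem _ fun k _ =>
      Submodule.smul_mem _ _ (Submodule.subset_span (Set.mem_range_self k))

theorem isVectorFieldOn_coordField [IsSuperManifold m n M] (he : e ∈ atlas (SuperSpace m n) M)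
    (k : Fin m ⊕ Fin n) : IsVectorFieldOn (m := m) (n := n) (coordField e k) e.source := by
  intro V hVe hV f hf
  have hderiv : IsGInfty (superDeriv k (fun x => f (e.symm x))) (e.target ∩ e.symm ⁻¹' V) :=
    fun r => (hf e he (r + 1)).superDeriv (e.symm.isOpen_inter_preimage hV) k
  have hVs : V ⊆ e.source ∩ e ⁻¹' (e.target ∩ e.symm ⁻¹' V) := fun x hx =>
    ⟨hVe hx, e.map_source (hVe hx), by simpa [e.left_inv (hVe hx)] using hx⟩
  refine ((isGInftyOn_comp_chart he hderiv).mono hVs).congr hV fun q hq => ?_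
  have hfq : IsGInftyAt m n f q := hf.isGInftyAt hV hq
  rw [applyFun, dif_pos hfq, coe_coordField he (hVe hq)]
  exact coordDeriv_germMk (hVe hq) k hfq

end CoordField

end Manifold

section PureFields

variable {m n : ℕ} {M : Type*} [TopologicalSpace M] [ChartedSpace (SuperSpace m n) M]

namespace IsPure

variable {p : M} {a : ZMod 2}

theorem zero (a : ZMod 2) : IsPure a (0 : SuperTangent m n p) where
  map_add _ _ := (add_zero 0).symm
  map_const_mul _ _ _ _ := by simp
  leibniz _ _ _ _ := by simp
  map_parity _ _ _ := zero_mem _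

theorem add {X Y : SuperTangent m n p} (hX : IsPure a X) (hY : IsPure a Y) :
    IsPure a (X + Y) where
  map_add F G := by
    simp only [Submodule.coe_add, Pi.add_apply, hX.map_add, hY.map_add]
    abel
  map_const_mul b c hc F := by
    simp only [Submodule.coe_add, Pi.add_apply, hX.map_const_mul b c hc, hY.map_const_mul b c hc,
      mul_add, smul_add]
  leibniz b F G hF := by
    simp only [Submodule.coe_add, Pi.add_apply, hX.leibniz b F G hF, hY.leibniz b F G hF,
      mul_add, add_mul, smul_add]
    abel
  map_parity b F hF := add_mem (hX.map_parity b F hF) (hY.map_parity b F hF)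

theorem smul {b : ZMod 2} {c : SuperNumber} (hc : c ∈ part b) {X : SuperTangent m n p}
    (hX : IsPure a X) : IsPure (b + a) (c • X) where
  map_add F G := by
    simp only [Submodule.coe_smul, Pi.smul_apply, hX.map_add, smul_add]
  map_const_mul b' c' hc' F := by
    simp only [Submodule.coe_smul, Pi.smul_apply, hX.map_const_mul b' c' hc', smul_eq_mul]
    rw [mul_smul_comm, ← mul_assoc, mul_comm_of_mem hc hc', smul_mul_assoc, smul_smul, mul_assoc,
      koszul_add_left, mul_comm (koszul a b')]
  leibniz b' F G hF := by
    simp only [Submodule.coe_smul, Pi.smul_apply, hX.leibniz b' F G hF, smul_eq_mul, mul_add]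
    rw [← mul_assoc, mul_smul_comm, ← mul_assoc c, mul_comm_of_mem hc (value_mem_part hF),
      smul_mul_assoc, smul_smul, mul_assoc, mul_assoc, koszul_add_left, mul_comm (koszul a b')]
  map_parity b' F hF := by
    rw [add_assoc]
    exact mul_mem_part hc (hX.map_parity b' F hF)

end IsPure

theorem applyFun_zero {p : M} (f : M → SuperNumber) :
    applyFun (0 : SuperTangent m n p) f = 0 := by
  unfold applyFun
  split_ifs <;> rfl

theorem applyFun_add {p : M} (X Y : SuperTangent m n p) (f : M → SuperNumber) :
    applyFun (X + Y) f = applyFun X f + applyFun Y f := by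
  unfold applyFun
  split_ifs
  · rfl
  · exact (add_zero 0).symm

theorem applyFun_smul {p : M} (c : SuperNumber) (X : SuperTangent m n p) (f : M → SuperNumber) :
    applyFun (c • X) f = c * applyFun X f := by
  unfold applyFun
  split_ifs
  · rfl
  · exact (mul_zero c).symm

variable (m n) in
/-- `c` restricts to a `G^∞` function on `U` whose values have parity `b`. -/
structure IsPureFunOn (b : ZMod 2) (c : M → SuperNumber) (U : Set M) : Prop where
  smooth : IsGInftyOn m n c U
  mem_part : ∀ q ∈ U, c q ∈ part b

/-- `X` restricts to a super vector field on `U` whose values are pure of parity `a`. -/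
structure IsPureFieldOn (a : ZMod 2) (X : ∀ q : M, SuperTangent m n q) (U : Set M) : Prop where
  isVectorFieldOn : IsVectorFieldOn X U
  isPure : ∀ q ∈ U, IsPure a (X q)

namespace IsPureFunOn

variable {a b : ZMod 2} {c d : M → SuperNumber} {U : Set M}

theorem const {c : SuperNumber} (hc : c ∈ part b) (U : Set M) :
    IsPureFunOn m n b (fun _ => c) U :=
  ⟨.const c U, fun _ _ => hc⟩

theorem neg (hc : IsPureFunOn m n b c U) : IsPureFunOn m n b (fun q => -c q) U :=
  ⟨hc.smooth.neg, fun q hq => neg_mem (hc.mem_part q hq)⟩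

theorem sub (hc : IsPureFunOn m n b c U) (hd : IsPureFunOn m n b d U) :
    IsPureFunOn m n b (fun q => c q - d q) U := by
  simp only [sub_eq_add_neg]
  exact ⟨hc.smooth.add hd.neg.smooth,
    fun q hq => add_mem (hc.mem_part q hq) (hd.neg.mem_part q hq)⟩

theorem mul (hc : IsPureFunOn m n a c U) (hd : IsPureFunOn m n b d U) :
    IsPureFunOn m n (a + b) (fun q => c q * d q) U :=
  ⟨hc.smooth.mul hd.smooth, fun q hq => mul_mem_part (hc.mem_part q hq) (hd.mem_part q hq)⟩

theorem ringInverse (hc : IsPureFunOn m n 0 c U) (hbody : ∀ q ∈ U, body (c q) ≠ 0) :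
    IsPureFunOn m n 0 (fun q => Ring.inverse (c q)) U :=
  have hinv : ∀ q ∈ U, Ring.inverse (c q) ∈ part 0 := fun q hq =>
    ringInverse_mem_part_zero (hc.mem_part q hq) (hbody q hq)
  ⟨hc.smooth.ringInverse fun q hq =>
    ⟨isUnit_of_mem_part_zero (hc.mem_part q hq) (hbody q hq), hinv q hq⟩, hinv⟩

end IsPureFunOn

theorem IsGInftyOn.isOpen_inter_body_ne_zero {c : M → SuperNumber} {U : Set M}
    (hc : IsGInftyOn m n c U) (hU : IsOpen U) : IsOpen (U ∩ {q | body (c q) ≠ 0}) :=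
  (continuous_body.comp_continuousOn (hc.continuousOn hU)).isOpen_inter_preimage hU
    isOpen_compl_singleton

namespace IsPureFieldOn

variable {a b : ZMod 2} {X Y : ∀ q : M, SuperTangent m n q} {U V : Set M}

theorem mono (hX : IsPureFieldOn a X U) (hVU : V ⊆ U) : IsPureFieldOn a X V :=
  ⟨fun W hW => hX.isVectorFieldOn W (hW.trans hVU), fun q hq => hX.isPure q (hVU hq)⟩

theorem zero (a : ZMod 2) (U : Set M) :
    IsPureFieldOn a (fun q => (0 : SuperTangent m n q)) U where
  isVectorFieldOn V _ _ f _ := by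
    simp only [applyFun_zero]
    exact .const 0 V
  isPure _ _ := .zero a

theorem add (hX : IsPureFieldOn a X U) (hY : IsPureFieldOn a Y U) :
    IsPureFieldOn a (fun q => X q + Y q) U where
  isVectorFieldOn V hVU hV f hf := by
    simp only [applyFun_add]
    exact (hX.isVectorFieldOn V hVU hV f hf).add (hY.isVectorFieldOn V hVU hV f hf)
  isPure q hq := (hX.isPure q hq).add (hY.isPure q hq)

theorem smul {c : M → SuperNumber} (hc : IsPureFunOn m n b c U) (hX : IsPureFieldOn a X U) :
    IsPureFieldOn (b + a) (fun q => c q • X q) U where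
  isVectorFieldOn V hVU hV f hf := by
    simp only [applyFun_smul]
    exact (hc.smooth.mono hVU).mul (hX.isVectorFieldOn V hVU hV f hf)
  isPure q hq := (hX.isPure q hq).smul (hc.mem_part q hq)

theorem sum {ι : Type*} (s : Finset ι) {X : ι → ∀ q : M, SuperTangent m n q}
    (hX : ∀ i ∈ s, IsPureFieldOn a (X i) U) : IsPureFieldOn a (fun q => ∑ i ∈ s, X i q) U := by
  classical
  induction s using Finset.induction_on with
  | empty => simpa using zero a U
  | insert i s hi ih =>
    simp only [Finset.sum_insert hi]
    exact (hX i (Finset.mem_insert_self i s)).add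
      (ih fun j hj => hX j (Finset.mem_insert_of_mem hj))

end IsPureFieldOn

/-- `x` is a frame of the super tangent spaces over `U`: super vector fields, the `i`-th one pure
of parity `a i`, that form a basis of the module `T_qM` at every point `q` of `U`. -/
structure IsPureFrameOn {ι : Type*} (a : ι → ZMod 2) (x : ι → ∀ q : M, SuperTangent m n q)
    (U : Set M) : Prop where
  isPureFieldOn : ∀ i, IsPureFieldOn (a i) (x i) U
  linearIndependent : ∀ q ∈ U, LinearIndependent SuperNumber fun i => x i q
  span_eq_top : ∀ q ∈ U, Submodule.span SuperNumber (Set.range fun i => x i q) = ⊤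

/-- The family of vector fields with coordinate matrix `C` in terms of the family `x`. -/
def changeFrame {ι : Type*} [Fintype ι] (C : M → Matrix ι ι SuperNumber)
    (x : ι → ∀ q : M, SuperTangent m n q) (i : ι) (q : M) : SuperTangent m n q :=
  ∑ j, C q i j • x j q

theorem isPureFrameOn_coordField [IsSuperManifold m n M]
    {e : OpenPartialHomeomorph M (SuperSpace m n)} (he : e ∈ atlas (SuperSpace m n) M) :
    IsPureFrameOn parity (coordField (m := m) (n := n) e) e.source where
  isPureFieldOn k := ⟨isVectorFieldOn_coordField he k, fun _ hq => isPure_coordField he hq k⟩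
  linearIndependent q hq := by
    refine Fintype.linearIndependent_iff.2 fun c hc j => ?_
    have happly := congrArg (fun X : SuperTangent m n q => X.1 (coordGerm he hq j)) hc
    simpa [-Fintype.sum_sum_type, coe_coordField he hq, coordDeriv_coordGerm, Pi.single_apply]
      using happly
  span_eq_top _ hq := span_coordField he hq

namespace IsPureFrameOn

variable {ι : Type*} {a : ι → ZMod 2} {x : ι → ∀ q : M, SuperTangent m n q} {U V : Set M}

theorem mono (hx : IsPureFrameOn a x U) (hVU : V ⊆ U) : IsPureFrameOn a x V :=
  ⟨fun i => (hx.isPureFieldOn i).mono hVU, fun q hq => hx.linearIndependent q (hVU hq),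
    fun q hq => hx.span_eq_top q (hVU hq)⟩

theorem smul {c : ι → M → SuperNumber} (hx : IsPureFrameOn a x U)
    (hc : ∀ i, IsPureFunOn m n 0 (c i) U) (hunit : ∀ q ∈ U, ∀ i, IsUnit (c i q)) :
    IsPureFrameOn a (fun i q => c i q • x i q) U where
  isPureFieldOn i := zero_add (a i) ▸ .smul (hc i) (hx.isPureFieldOn i)
  linearIndependent q hq :=
    (hx.linearIndependent q hq).units_smul fun i => (hunit q hq i).unit
  span_eq_top q hq :=
    Module.Basis.units_smul_span_eq_top (hx.span_eq_top q hq) (w := fun i => (hunit q hq i).unit)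

end IsPureFrameOn

section ChangeFrame

open scoped Matrix

variable {ι : Type*} [Fintype ι] {a : ι → ZMod 2} {x : ι → ∀ q : M, SuperTangent m n q} {U : Set M}

theorem sum_smul_changeFrame (C : M → Matrix ι ι SuperNumber) (c : ι → SuperNumber) (q : M) :
    ∑ i, c i • changeFrame C x i q = ∑ j, (c ᵥ* C q) j • x j q := by
  simp only [changeFrame, Finset.smul_sum, smul_smul, Matrix.vecMul, dotProduct, Finset.sum_smul]
  exact Finset.sum_comm

theorem IsPureFrameOn.changeFrame [DecidableEq ι] {C : M → Matrix ι ι SuperNumber}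
    (hx : IsPureFrameOn a x U) (hC : ∀ i j, IsPureFunOn m n (a i + a j) (fun q => C q i j) U)
    (hunit : ∀ q ∈ U, IsUnit (C q)) : IsPureFrameOn a (changeFrame C x) U where
  isPureFieldOn i := IsPureFieldOn.sum _ fun j _ => by
    simpa [add_assoc, CharTwo.add_self_eq_zero] using (hx.isPureFieldOn j).smul (hC i j)
  linearIndependent q hq := by
    refine Fintype.linearIndependent_iff.2 fun c hc => ?_
    obtain ⟨C', hC'⟩ := (hunit q hq).exists_right_inv
    rw [sum_smul_changeFrame] at hc
    have hvec : c ᵥ* C q = 0 :=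
      funext (Fintype.linearIndependent_iff.1 (hx.linearIndependent q hq) _ hc)
    have hc_zero : c = 0 := by
      rw [← Matrix.vecMul_one c, ← hC', ← Matrix.vecMul_vecMul, hvec, Matrix.zero_vecMul]
    exact congrFun hc_zero
  span_eq_top q hq := by
    obtain ⟨C', hC'⟩ := (hunit q hq).exists_left_inv
    refine eq_top_iff.2 ((hx.span_eq_top q hq).symm.trans_le (Submodule.span_le.2 ?_))
    rintro _ ⟨i, rfl⟩
    have hxi : x i q = ∑ k, C' i k • SuperGeometry.changeFrame C x k q := by
      rw [sum_smul_changeFrame, ← Matrix.mul_apply_eq_vecMul, hC']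
      simp [Matrix.one_apply]
    exact (hxi ▸ Submodule.sum_mem _ fun k _ =>
      Submodule.smul_mem _ _ (Submodule.subset_span (Set.mem_range_self k)) :)

end ChangeFrame

end PureFields

section Metric

variable {m n : ℕ} {M : Type*} [TopologicalSpace M] [ChartedSpace (SuperSpace m n) M]

namespace SuperRiemannianMetric

variable (g : SuperRiemannianMetric m n M) {q : M}

/-- The left linear functional `g_q(·, z)`. -/
def left (q : M) (z : SuperTangent m n q) : SuperTangent m n q →ₗ[SuperNumber] SuperNumber where
  toFun x := g.val q x z
  map_add' x y := by simpa using g.linear_left q 1 1 x y z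
  map_smul' c x := by simpa using g.linear_left q c 0 x 0 z

theorem val_smul_left (c : SuperNumber) (x z : SuperTangent m n q) :
    g.val q (c • x) z = c * g.val q x z :=
  (g.left q z).map_smul c x

theorem val_sub_left (x y z : SuperTangent m n q) :
    g.val q (x - y) z = g.val q x z - g.val q y z :=
  (g.left q z).map_sub x y

theorem val_sum_left {ι : Type*} (s : Finset ι) (x : ι → SuperTangent m n q)
    (z : SuperTangent m n q) : g.val q (∑ i ∈ s, x i) z = ∑ i ∈ s, g.val q (x i) z :=
  map_sum (g.left q z) x s

theorem val_sum_right {ι : Type*} (s : Finset ι) (x : ι → SuperTangent m n q)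
    (z : SuperTangent m n q) : g.val q z (∑ i ∈ s, x i) = ∑ i ∈ s, g.val q z (x i) :=
  map_sum (AddMonoidHom.mk' (g.val q z) (g.add_right q z)) x s

section Pure

variable {a b c : ZMod 2} {x y : SuperTangent m n q} {r : SuperNumber}

theorem val_smul_right (hx : IsPure a x) (hy : IsPure b y) (hr : r ∈ part c) :
    g.val q x (r • y) = koszul a c • (r * g.val q x y) := by
  rw [g.symm q a (c + b) x _ hx (hy.smul hr), val_smul_left, g.symm q b a y x hy hx,
    mul_smul_comm, smul_smul, koszul_comm, koszul_add_left, koszul_comm b a, mul_assoc,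
    koszul_mul_self, mul_one, koszul_comm]

theorem val_eq_zero_comm (hx : IsPure a x) (hy : IsPure b y) :
    g.val q x y = 0 ↔ g.val q y x = 0 := by
  constructor <;> intro h
  · rw [g.symm q b a y x hy hx, h, smul_zero]
  · rw [g.symm q a b x y hx hy, h, smul_zero]

theorem val_self_eq_zero_of_odd (hx : IsPure 1 x) : g.val q x x = 0 := by
  have hneg : g.val q x x = -g.val q x x := by simpa using g.symm q 1 1 x x hx hx
  have htwo : (2 : ℝ) • g.val q x x = 0 := by
    rw [two_smul]
    exact eq_neg_iff_add_eq_zero.1 hneg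
  exact (smul_eq_zero_iff_right two_ne_zero).1 htwo

theorem body_val_smul_right (hx : IsPure a x) (hy : IsPure b y) (r : SuperNumber) :
    body (g.val q x (r • y)) = body r * body (g.val q x y) := by
  rw [← proj_add_proj r, add_smul, g.add_right, g.val_smul_right hx hy (proj 0 r).2,
    g.val_smul_right hx hy (proj 1 r).2]
  simp [body_of_odd (proj 1 r).2, body_smul]

end Pure

theorem isPureFunOn_val {a b : ZMod 2} {X Y : ∀ q : M, SuperTangent m n q} {U : Set M}
    (hU : IsOpen U) (hX : IsPureFieldOn a X U) (hY : IsPureFieldOn b Y U) :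
    IsPureFunOn m n (a + b) (fun q => g.val q (X q) (Y q)) U :=
  ⟨g.smooth U hU X Y hX.isVectorFieldOn hY.isVectorFieldOn,
    fun q hq => g.even q a b _ _ (hX.isPure q hq) (hY.isPure q hq)⟩

/-- The body of the Gram matrix of a family of vector fields at the point `p`. -/
def bodyGram {ι : Type*} (p : M) (x : ι → ∀ q : M, SuperTangent m n q) : Matrix ι ι ℝ :=
  Matrix.of fun i j => body (g.val p (x i p) (x j p))

section BodyGram

open scoped Matrix

variable {ι : Type*} {a : ι → ZMod 2} {x : ι → ∀ q : M, SuperTangent m n q} {p : M}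

theorem bodyGram_apply (i j : ι) : g.bodyGram p x i j = body (g.val p (x i p) (x j p)) := rfl

theorem bodyGram_apply_eq_zero (hx : ∀ i, IsPure (a i) (x i p)) {i j : ι} (hij : a i + a j = 1) :
    g.bodyGram p x i j = 0 :=
  body_of_odd (hij ▸ g.even p _ _ _ _ (hx i) (hx j))

theorem bodyGram_apply_comm (hx : ∀ i, IsPure (a i) (x i p)) (i j : ι) :
    g.bodyGram p x i j = koszul (a i) (a j) * g.bodyGram p x j i := by
  rw [bodyGram_apply, g.symm p _ _ _ _ (hx i) (hx j), body_smul, bodyGram_apply]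

variable [Fintype ι]

theorem bodyGram_changeFrame (hx : ∀ i, IsPure (a i) (x i p)) (C : M → Matrix ι ι SuperNumber) :
    g.bodyGram p (changeFrame C x) =
      (C p).map body * g.bodyGram p x * ((C p).map body)ᵀ := by
  ext i j
  simp only [bodyGram_apply, changeFrame, val_sum_left, val_sum_right, val_smul_left, map_sum,
    map_mul, g.body_val_smul_right (hx _) (hx _), Matrix.mul_apply, Matrix.transpose_apply,
    Matrix.map_apply, Finset.sum_mul]
  exact Finset.sum_congr rfl fun l _ => Finset.sum_congr rfl fun k _ => by ring

/-- The columns of the inverse are the bodies of the coordinates of the vectors that represent the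
dual basis of the frame under the metric. -/
theorem isUnit_bodyGram [DecidableEq ι] {U : Set M} (hx : IsPureFrameOn a x U) (hp : p ∈ U) :
    IsUnit (g.bodyGram p x) := by
  have hpure := fun i => (hx.isPureFieldOn i).isPure p hp
  let e : Module.Basis ι SuperNumber (SuperTangent m n p) :=
    .mk (hx.linearIndependent p hp) (hx.span_eq_top p hp).ge
  choose z hz using fun k => g.perfect p (e.coord k)
  have hinv : g.bodyGram p x * Matrix.of (fun j k => body (e.repr (z k) j)) = 1 := by
    ext i k
    calc ∑ j, g.bodyGram p x i j * body (e.repr (z k) j)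
        = body (g.val p (x i p) (∑ j, e.repr (z k) j • e j)) := by
          simp [e, val_sum_right, g.body_val_smul_right (hpure _) (hpure _), bodyGram_apply,
            mul_comm]
      _ = body (e.coord k (e i)) := by
          rw [e.sum_repr, ← hz, Module.Basis.mk_apply]
      _ = (1 : Matrix ι ι ℝ) i k := by
          rw [e.coord_apply, e.repr_self, Finsupp.single_apply, Matrix.one_apply]
          split_ifs <;> simp
  exact .of_mul_eq_one _ hinv

end BodyGram

end SuperRiemannianMetric

end Metric

section LinearAlgebra

open LinearMap (BilinForm)
open Module (finrank)
open scoped Matrix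

/-- `i` and `j` are the two indices, counted from `0`, of one diagonal `2 × 2` block of the matrix
`𝒥`. -/
def IsBlockPair (i j : ℕ) : Prop := (Even i ∧ j = i + 1) ∨ (Even j ∧ i = j + 1)

theorem isBlockPair_add_two {i j : ℕ} : IsBlockPair (i + 2) (j + 2) ↔ IsBlockPair i j := by
  unfold IsBlockPair
  grind

/-- The index that shares the diagonal `2 × 2` block of the matrix `𝒥` with the index `i`. -/
def blockPartner {n : ℕ} (hn : Even n) (i : Fin n) : Fin n :=
  ⟨if Even (i : ℕ) then i + 1 else i - 1, by grind⟩

theorem isBlockPair_iff_eq_blockPartner {n : ℕ} (hn : Even n) {i j : Fin n} :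
    IsBlockPair i j ↔ j = blockPartner hn i := by
  simp only [IsBlockPair, blockPartner, Fin.ext_iff]
  grind

theorem blockPartner_involutive {n : ℕ} (hn : Even n) : (blockPartner hn).Involutive := by
  intro i
  simp only [blockPartner, Fin.ext_iff]
  grind

theorem even_blockPartner_iff {n : ℕ} (hn : Even n) (i : Fin n) :
    Even (blockPartner hn i : ℕ) ↔ ¬Even (i : ℕ) := by
  simp only [blockPartner]
  grind

theorem blockJ_apply {n : ℕ} (hn : Even n) (i j : Fin n) :
    blockJ n i j = if j = blockPartner hn i then (if Even (i : ℕ) then 1 else -1) else 0 := by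
  simp only [blockJ, Matrix.of_apply, blockPartner, Fin.ext_iff]
  grind

section Symplectic

variable {K V : Type*} [Field K] [AddCommGroup V] [Module K V] {B : BilinForm K V} {u v : V}

theorem eq_zero_of_apply_smul_add_smul (hB : B.IsAlt) (huv : B u v ≠ 0) {r s : K}
    (hu : B u (r • u + s • v) = 0) (hv : B v (r • u + s • v) = 0) : r = 0 ∧ s = 0 := by
  have hvu : B v u ≠ 0 := fun h => huv (hB.eq_iff.1 h)
  simp_all [hB.self_eq_zero]

theorem linearIndependent_pair_of_isAlt (hB : B.IsAlt) (huv : B u v ≠ 0) :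
    LinearIndependent K ![u, v] :=
  LinearIndependent.pair_iff.2 fun r s h =>
    eq_zero_of_apply_smul_add_smul hB huv (by rw [h, map_zero]) (by rw [h, map_zero])

theorem disjoint_span_pair_orthogonal (hB : B.IsAlt) (huv : B u v ≠ 0) :
    Disjoint (Submodule.span K {u, v}) (B.orthogonal (Submodule.span K {u, v})) := by
  refine Submodule.disjoint_def.2 fun x hx hx_orth => ?_
  obtain ⟨r, s, rfl⟩ := Submodule.mem_span_pair.1 hx
  obtain ⟨rfl, rfl⟩ := eq_zero_of_apply_smul_add_smul hB huv
    (hx_orth u (Submodule.subset_span (by simp))) (hx_orth v (Submodule.subset_span (by simp)))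
  simp

theorem exists_apply_ne_zero [Nontrivial V] (hnondeg : B.Nondegenerate) : ∃ u v, B u v ≠ 0 := by
  obtain ⟨u, hu⟩ := exists_ne (0 : V)
  by_contra! h
  exact hu (hnondeg.1 u (h u))

theorem exists_symplectic_family (n : ℕ) [FiniteDimensional K V] (hB : B.IsAlt)
    (hnondeg : B.Nondegenerate) (hn : finrank K V = n) :
    Even n ∧ ∃ v : Fin n → V, ∀ i j : Fin n, B (v i) (v j) ≠ 0 ↔ IsBlockPair i j := by
  induction n using Nat.twoStepInduction generalizing V with
  | zero => exact ⟨.zero, Fin.elim0, fun i => i.elim0⟩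
  | one =>
    have := Module.finrank_pos_iff.1 (by omega : 0 < finrank K V)
    obtain ⟨u, v, huv⟩ := exists_apply_ne_zero hnondeg
    have hcard := (linearIndependent_pair_of_isAlt hB huv).fintype_card_le_finrank
    simp [hn] at hcard
  | more n ih _ =>
    have := Module.finrank_pos_iff.1 (by omega : 0 < finrank K V)
    obtain ⟨u, v, huv⟩ := exists_apply_ne_zero hnondeg
    have hvu : B v u ≠ 0 := fun h => huv (hB.eq_iff.1 h)
    let W := Submodule.span K {u, v}
    have hW : finrank K W = 2 := by
      have hcard := finrank_span_eq_card (linearIndependent_pair_of_isAlt hB huv)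
      rwa [Matrix.range_cons_cons_empty, Fintype.card_fin] at hcard
    have hdisj : Disjoint (B.orthogonal W) (B.orthogonal (B.orthogonal W)) := by
      rw [BilinForm.orthogonal_orthogonal hnondeg hB.isRefl]
      exact (disjoint_span_pair_orthogonal hB huv).symm
    obtain ⟨hn_even, w, hw⟩ := ih (V := B.orthogonal W) (B := B.restrict (B.orthogonal W))
      (fun x => hB x) (B.nondegenerate_restrict_of_disjoint_orthogonal hB.isRefl hdisj)
      (by rw [BilinForm.finrank_orthogonal hnondeg, hn, hW, Nat.add_sub_cancel])
    have hu : ∀ i, B u (w i) = 0 := fun i => (w i).2 u (Submodule.subset_span (by simp))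
    have hv : ∀ i, B v (w i) = 0 := fun i => (w i).2 v (Submodule.subset_span (by simp))
    refine ⟨hn_even.add even_two, Fin.cons u (Fin.cons v fun i => (w i : V)), fun i j => ?_⟩
    have hu' : ∀ i, B (w i) u = 0 := fun i => hB.eq_iff.1 (hu i)
    have hv' : ∀ i, B (w i) v = 0 := fun i => hB.eq_iff.1 (hv i)
    refine Fin.cases ?_ (Fin.cases ?_ fun i => ?_) i <;>
      refine Fin.cases ?_ (Fin.cases ?_ fun j => ?_) j
    case refine_3.refine_3 => exact (hw i j).trans isBlockPair_add_two.symm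
    all_goals simp [IsBlockPair, hB.self_eq_zero, hu, hv, hu', hv', huv, hvu]

end Symplectic

section NormalForm

variable {ι : Type*} [Fintype ι] [DecidableEq ι]

theorem isUnit_of_ne_zero_iff {K : Type*} [Field K] {A : Matrix ι ι K} {σ : ι → ι}
    (hσ : σ.Injective) (hA : ∀ i j, A i j ≠ 0 ↔ j = σ i) : IsUnit A := by
  refine Matrix.vecMul_injective_iff_isUnit.1
    ((injective_iff_map_eq_zero A.vecMulLinear).2 fun c hc => funext fun k => ?_)
  have hzero : ∀ i ≠ k, c i * A i (σ k) = 0 := fun i hi => by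
    rw [not_not.1 (mt (hA i (σ k)).1 (hσ.ne hi.symm)), mul_zero]
  have hk : ∑ i, c i * A i (σ k) = 0 := congrFun hc (σ k)
  rw [Finset.sum_eq_single k (fun i _ => hzero i) (by simp)] at hk
  exact (mul_eq_zero.1 hk).resolve_right ((hA k (σ k)).2 rfl)

theorem exists_congruence_diagonal {A : Matrix ι ι ℝ} (hA : A.IsSymm)
    (hunit : IsUnit A) : ∃ P : Matrix ι ι ℝ, ∀ i j, (P * A * Pᵀ) i j ≠ 0 ↔ j = i := by
  have hherm : A.IsHermitian := hA
  have hne : ∀ i, hherm.eigenvalues i ≠ 0 := by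
    have hdet := ((Matrix.isUnit_iff_isUnit_det A).1 hunit).ne_zero
    rw [hherm.det_eq_prod_eigenvalues] at hdet
    simpa [Finset.prod_ne_zero_iff] using hdet
  refine ⟨star (hherm.eigenvectorUnitary : Matrix ι ι ℝ), fun i j => ?_⟩
  have hdiag := hherm.conjStarAlgAut_star_eigenvectorUnitary
  rw [Unitary.conjStarAlgAut_star_apply] at hdiag
  have htranspose : (star (hherm.eigenvectorUnitary : Matrix ι ι ℝ))ᵀ =
      hherm.eigenvectorUnitary := by
    ext
    simp
  rw [htranspose, hdiag, Matrix.diagonal_apply]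
  simp [hne, @eq_comm _ j i]

theorem exists_congruence_isBlockPair {n : ℕ} {A : Matrix (Fin n) (Fin n) ℝ} (hA : Aᵀ = -A)
    (hunit : IsUnit A) :
    Even n ∧ ∃ P : Matrix (Fin n) (Fin n) ℝ, ∀ i j, (P * A * Pᵀ) i j ≠ 0 ↔ IsBlockPair i j := by
  have halt : A.toBilin'.IsAlt := fun x => by
    have hneg : x ⬝ᵥ A *ᵥ x = -(x ⬝ᵥ A *ᵥ x) := by
      conv_lhs => rw [← A.transpose_transpose, Matrix.mulVec_transpose, hA, dotProduct_comm,
        ← Matrix.dotProduct_mulVec, Matrix.neg_mulVec, dotProduct_neg]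
    rw [Matrix.toBilin'_apply']
    linarith
  have hnondeg : A.toBilin'.Nondegenerate := BilinForm.nondegenerate_toBilin'_of_det_ne_zero' A
    ((Matrix.isUnit_iff_isUnit_det A).1 hunit).ne_zero
  obtain ⟨hn, v, hv⟩ := exists_symplectic_family n halt hnondeg (Module.finrank_fin_fun ℝ)
  refine ⟨hn, Matrix.of v, fun i j => ?_⟩
  rw [← hv, Matrix.toBilin'_apply', Matrix.mul_mul_apply]
  rfl

theorem exists_congruence_fromBlocks {n : ℕ} {A₀ : Matrix ι ι ℝ} {A₁ : Matrix (Fin n) (Fin n) ℝ}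
    (hA₀ : A₀.IsSymm) (hA₁ : A₁ᵀ = -A₁) (hunit : IsUnit (Matrix.fromBlocks A₀ 0 0 A₁)) :
    ∃ hn : Even n, ∃ (P₀ : Matrix ι ι ℝ) (P₁ : Matrix (Fin n) (Fin n) ℝ),
      IsUnit (Matrix.fromBlocks P₀ 0 0 P₁) ∧
      ∀ k l, (Matrix.fromBlocks P₀ 0 0 P₁ * Matrix.fromBlocks A₀ 0 0 A₁ *
        (Matrix.fromBlocks P₀ 0 0 P₁)ᵀ) k l ≠ 0 ↔ l = Sum.map id (blockPartner hn) k := by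
  obtain ⟨hunit₀, hunit₁⟩ := Matrix.isUnit_fromBlocks_zero₂₁.1 hunit
  obtain ⟨P₀, hP₀⟩ := exists_congruence_diagonal hA₀ hunit₀
  obtain ⟨hn, P₁, hP₁⟩ := exists_congruence_isBlockPair hA₁ hunit₁
  have hpattern : ∀ k l, (Matrix.fromBlocks P₀ 0 0 P₁ * Matrix.fromBlocks A₀ 0 0 A₁ *
      (Matrix.fromBlocks P₀ 0 0 P₁)ᵀ) k l ≠ 0 ↔ l = Sum.map id (blockPartner hn) k := by
    simp only [isBlockPair_iff_eq_blockPartner hn] at hP₁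
    rintro (i | i) (j | j)
    · simpa [Matrix.fromBlocks_transpose, Matrix.fromBlocks_multiply] using hP₀ i j
    · simp [Matrix.fromBlocks_transpose, Matrix.fromBlocks_multiply]
    · simp [Matrix.fromBlocks_transpose, Matrix.fromBlocks_multiply]
    · simpa [Matrix.fromBlocks_transpose, Matrix.fromBlocks_multiply] using hP₁ i j
  have hinj : (Sum.map id (blockPartner hn) : ι ⊕ Fin n → ι ⊕ Fin n).Injective :=
    Function.injective_id.sumMap (blockPartner_involutive hn).injective
  have hdet := (Matrix.isUnit_iff_isUnit_det _).1 (isUnit_of_ne_zero_iff hinj hpattern)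
  rw [Matrix.mul_assoc, Matrix.det_mul] at hdet
  exact ⟨hn, P₀, P₁, (Matrix.isUnit_iff_isUnit_det _).2 (isUnit_of_mul_isUnit_left hdet), hpattern⟩

end NormalForm

end LinearAlgebra

section BodyNormalForm

variable {m n : ℕ} {M : Type*} [TopologicalSpace M] [ChartedSpace (SuperSpace m n) M]

namespace IsPureFrameOn

theorem constChangeFrame {ι : Type*} [Fintype ι] [DecidableEq ι] {a : ι → ZMod 2}
    {x : ι → ∀ q : M, SuperTangent m n q} {U : Set M} (hx : IsPureFrameOn a x U)
    {P : Matrix ι ι ℝ} (hP : ∀ i j, P i j ≠ 0 → a i = a j) (hunit : IsUnit P) :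
    IsPureFrameOn a
      (SuperGeometry.changeFrame (fun _ => P.map (algebraMap ℝ SuperNumber)) x) U := by
  refine hx.changeFrame (fun i j => .const ?_ U)
    fun _ _ => hunit.map (algebraMap ℝ SuperNumber).mapMatrix
  by_cases hij : P i j = 0
  · simp [hij]
  · rw [hP i j hij, CharTwo.add_self_eq_zero]
    exact algebraMap_mem_part _

end IsPureFrameOn

namespace SuperRiemannianMetric

variable (g : SuperRiemannianMetric m n M)

open scoped Matrix

theorem bodyGram_eq_fromBlocks {x : Fin m ⊕ Fin n → ∀ q : M, SuperTangent m n q} {p : M}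
    (hx : ∀ k, IsPure (parity k) (x k p)) :
    g.bodyGram p x =
      Matrix.fromBlocks (g.bodyGram p x).toBlocks₁₁ 0 0 (g.bodyGram p x).toBlocks₂₂ := by
  conv_lhs => rw [← Matrix.fromBlocks_toBlocks (g.bodyGram p x)]
  congr 1 <;> ext i j <;> exact g.bodyGram_apply_eq_zero hx (by simp [parity])

/-- The invertible body of the Gram matrix is symmetric on the even coordinate fields and
skew-symmetric on the odd ones, so that it has a normal form over `ℝ`. -/
theorem exists_frame_bodyGram_ne_zero_iff [IsSuperManifold m n M] (p : M) :
    ∃ hn : Even n, ∃ U : Set M, IsOpen U ∧ p ∈ U ∧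
      ∃ x : Fin m ⊕ Fin n → ∀ q : M, SuperTangent m n q, IsPureFrameOn parity x U ∧
        ∀ k l, g.bodyGram p x k l ≠ 0 ↔ l = Sum.map id (blockPartner hn) k := by
  have hp : p ∈ (chartAt (SuperSpace m n) p).source := mem_chart_source _ p
  have hframe := isPureFrameOn_coordField (chart_mem_atlas (SuperSpace m n) p)
  have hpure := fun k => (hframe.isPureFieldOn k).isPure p hp
  have hblocks := g.bodyGram_eq_fromBlocks hpure
  have hunit := g.isUnit_bodyGram hframe hp
  rw [hblocks] at hunit
  obtain ⟨hn, P₀, P₁, hP, hpattern⟩ := exists_congruence_fromBlocks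
    (by
      ext i j
      simpa [parity] using! g.bodyGram_apply_comm hpure (Sum.inl j) (Sum.inl i))
    (by
      ext i j
      simpa [parity] using! g.bodyGram_apply_comm hpure (Sum.inr j) (Sum.inr i)) hunit
  refine ⟨hn, _, (chartAt _ p).open_source, hp, _, hframe.constChangeFrame ?_ hP, ?_⟩
  · rintro (i | i) (j | j) h
    · rfl
    · exact absurd rfl h
    · exact absurd rfl h
    · rfl
  · have hbody : ((Matrix.fromBlocks P₀ 0 0 P₁).map (algebraMap ℝ SuperNumber)).map body =
        Matrix.fromBlocks P₀ 0 0 P₁ := by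
      ext
      simp [body_algebraMap]
    rwa [g.bodyGram_changeFrame hpure, hbody, hblocks]

end SuperRiemannianMetric

end BodyNormalForm

section GramSchmidt

variable {m n : ℕ} {M : Type*} [TopologicalSpace M] [ChartedSpace (SuperSpace m n) M]
  {ι : Type*} {a : ι → ZMod 2} {σ : ι → ι} {x : ι → ∀ q : M, SuperTangent m n q} {U : Set M}
  {p q : M}

/-- `σ` is a pattern for the nonzero entries of the Gram matrix of a frame with parities `a`: the
`i`-th field is to be orthogonal to all but the `σ i`-th one. Partners have the same parity, and
distinct partners are odd. -/
structure IsPairing (a : ι → ZMod 2) (σ : ι → ι) : Prop where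
  involutive : σ.Involutive
  parity_apply : ∀ i, a (σ i) = a i
  odd_of_ne : ∀ i, σ i ≠ i → a i = 1

theorem IsPairing.parity_add_parity (hσ : IsPairing a σ) (i : ι) : a i + a (σ i) = 0 := by
  rw [hσ.parity_apply, CharTwo.add_self_eq_zero]

namespace SuperRiemannianMetric

variable (g : SuperRiemannianMetric m n M)

theorem isPureFunOn_pivot (hσ : IsPairing a σ) (hU : IsOpen U) (hx : IsPureFrameOn a x U) (i : ι) :
    IsPureFunOn m n 0 (fun q => g.val q (x i q) (x (σ i) q)) U :=
  hσ.parity_add_parity i ▸ g.isPureFunOn_val hU (hx.isPureFieldOn i) (hx.isPureFieldOn (σ i))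

theorem exists_isOpen_bodyGram_ne_zero [Finite ι] (hσ : IsPairing a σ) (hU : IsOpen U) (hp : p ∈ U)
    (hx : IsPureFrameOn a x U) (hpivot : ∀ i, g.bodyGram p x i (σ i) ≠ 0) :
    ∃ V ⊆ U, IsOpen V ∧ p ∈ V ∧ ∀ q ∈ V, ∀ i, g.bodyGram q x i (σ i) ≠ 0 := by
  have hnear : ∀ᶠ q in 𝓝 p, q ∈ U ∧ ∀ i, g.bodyGram q x i (σ i) ≠ 0 := by
    refine (hU.eventually_mem hp).and (eventually_all.2 fun i => ?_)
    have hopen := (g.isPureFunOn_pivot hσ hU hx i).smooth.isOpen_inter_body_ne_zero hU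
    exact (hopen.eventually_mem ⟨hp, hpivot i⟩).mono fun q hq => hq.2
  obtain ⟨V, hV, hVopen, hpV⟩ := eventually_nhds_iff.1 hnear
  exact ⟨V, fun q hq => (hV q hq).1, hVopen, hpV, fun q hq => (hV q hq).2⟩

theorem isUnit_pivot (hσ : IsPairing a σ) (hx : ∀ i, IsPure (a i) (x i q)) {i : ι}
    (hpivot : g.bodyGram q x i (σ i) ≠ 0) : IsUnit (g.val q (x i q) (x (σ i) q)) :=
  isUnit_of_mem_part_zero (hσ.parity_add_parity i ▸ g.even q _ _ _ _ (hx i) (hx (σ i))) hpivot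

section GramSchmidtStep

variable [DecidableEq ι]

/-- The coefficients with which the fields indexed by `T` are subtracted from the other ones in
order to make those orthogonal to the fields indexed by `T`. -/
def gramSchmidtCoeff (σ : ι → ι) (T : Finset ι) (x : ι → ∀ q : M, SuperTangent m n q) (q : M) :
    Matrix ι ι SuperNumber := Matrix.of fun j l =>
  if j ∉ T ∧ l ∈ T then
    g.val q (x j q) (x (σ l) q) * Ring.inverse (g.val q (x l q) (x (σ l) q))
  else 0

variable {T : Finset ι}

theorem isPureFunOn_gramSchmidtCoeff (hσ : IsPairing a σ) (hU : IsOpen U)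
    (hx : IsPureFrameOn a x U) (hpivot : ∀ q ∈ U, ∀ i, g.bodyGram q x i (σ i) ≠ 0) (i j : ι) :
    IsPureFunOn m n (a i + a j) (fun q => g.gramSchmidtCoeff σ T x q i j) U := by
  by_cases hij : i ∉ T ∧ j ∈ T
  · simpa [gramSchmidtCoeff, hij, hσ.parity_apply] using
      (g.isPureFunOn_val hU (hx.isPureFieldOn i) (hx.isPureFieldOn (σ j))).mul
        ((g.isPureFunOn_pivot hσ hU hx j).ringInverse fun q hq => hpivot q hq j)
  · simpa only [gramSchmidtCoeff, Matrix.of_apply, if_neg hij] using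
      IsPureFunOn.const (zero_mem (part (a i + a j))) U

variable [Fintype ι]

/-- The Gram–Schmidt step that makes the fields indexed by the complement of `T` orthogonal to
those indexed by `T`, which it keeps. -/
def gramSchmidt (σ : ι → ι) (T : Finset ι) (x : ι → ∀ q : M, SuperTangent m n q) :
    ι → ∀ q : M, SuperTangent m n q :=
  changeFrame (fun q => 1 - g.gramSchmidtCoeff σ T x q) x

theorem gramSchmidt_apply (i : ι) :
    g.gramSchmidt σ T x i q = x i q - ∑ l, g.gramSchmidtCoeff σ T x q i l • x l q := by
  have hterm : ∀ l, (1 - g.gramSchmidtCoeff σ T x q) i l • x l q =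
      (1 : Matrix ι ι SuperNumber) i l • x l q - g.gramSchmidtCoeff σ T x q i l • x l q :=
    fun l => sub_smul ((1 : Matrix ι ι SuperNumber) i l) _ (x l q)
  simp only [gramSchmidt, changeFrame, hterm, Finset.sum_sub_distrib]
  simp [Matrix.one_apply]

theorem gramSchmidt_eq_self {i : ι} (hi : ∀ l, g.gramSchmidtCoeff σ T x q i l = 0) :
    g.gramSchmidt σ T x i q = x i q := by
  simp [gramSchmidt_apply, hi]

theorem gramSchmidt_of_mem {i : ι} (hi : i ∈ T) : g.gramSchmidt σ T x i q = x i q :=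
  g.gramSchmidt_eq_self fun l => by simp [gramSchmidtCoeff, hi]

theorem gramSchmidtCoeff_mul_self :
    g.gramSchmidtCoeff σ T x q * g.gramSchmidtCoeff σ T x q = 0 := by
  ext i j
  have hterm : ∀ k, g.gramSchmidtCoeff σ T x q i k * g.gramSchmidtCoeff σ T x q k j = 0 :=
    fun k => by by_cases hk : k ∈ T <;> simp [gramSchmidtCoeff, hk]
  simp [Matrix.mul_apply, hterm]

theorem isPureFrameOn_gramSchmidt (hσ : IsPairing a σ) (hU : IsOpen U) (hx : IsPureFrameOn a x U)
    (hpivot : ∀ q ∈ U, ∀ i, g.bodyGram q x i (σ i) ≠ 0) :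
    IsPureFrameOn a (g.gramSchmidt σ T x) U := by
  have hunit : ∀ q, IsUnit (1 - g.gramSchmidtCoeff σ T x q) := fun q =>
    IsNilpotent.isUnit_one_sub ⟨2, by rw [pow_two, gramSchmidtCoeff_mul_self]⟩
  refine hx.changeFrame (fun i j => ?_) fun q _ => hunit q
  have hone : (1 : Matrix ι ι SuperNumber) i j ∈ part (a i + a j) := by
    obtain rfl | hij := eq_or_ne i j
    · simpa [CharTwo.add_self_eq_zero] using one_mem_part
    · simp [hij]
  exact (IsPureFunOn.const hone U).sub (g.isPureFunOn_gramSchmidtCoeff hσ hU hx hpivot i j)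

theorem bodyGram_gramSchmidt (hσ : IsPairing a σ) (hx : ∀ i, IsPure (a i) (x i p))
    (horth : ∀ i j, j ≠ σ i → g.bodyGram p x i j = 0) :
    g.bodyGram p (g.gramSchmidt σ T x) = g.bodyGram p x := by
  have hcoeff : (1 - g.gramSchmidtCoeff σ T x p).map body = 1 := by
    ext i j
    have hij : body (g.gramSchmidtCoeff σ T x p i j) = 0 := by
      simp only [gramSchmidtCoeff, Matrix.of_apply]
      split_ifs with h
      · have hne : σ j ≠ σ i := hσ.involutive.injective.ne (by grind)
        rw [map_mul, ← bodyGram_apply, horth i (σ j) hne, zero_mul]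
      · exact map_zero body
    rw [Matrix.map_apply, Matrix.sub_apply, map_sub, hij, sub_zero]
    simp [Matrix.one_apply, apply_ite body]
  rw [gramSchmidt, g.bodyGram_changeFrame hx, hcoeff, one_mul, Matrix.transpose_one, mul_one]

theorem val_gramSchmidt_eq_zero (hσ : IsPairing a σ) (hx : ∀ i, IsPure (a i) (x i q))
    (hpivot : ∀ i, g.bodyGram q x i (σ i) ≠ 0) (hT : ∀ i ∈ T, σ i ∈ T)
    (horth : ∀ i ∈ T, ∀ j ∈ T, j ≠ σ i → g.val q (x i q) (x j q) = 0) {i j : ι} (hi : i ∉ T)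
    (hj : j ∈ T) : g.val q (g.gramSchmidt σ T x i q) (x j q) = 0 := by
  have hterm : ∀ l ≠ σ j, g.gramSchmidtCoeff σ T x q i l * g.val q (x l q) (x j q) = 0 := by
    intro l hl
    by_cases hlT : l ∈ T
    · rw [horth l hlT j hj fun h => hl (by rw [h, hσ.involutive]), mul_zero]
    · simp [gramSchmidtCoeff, hlT]
  have hunit := g.isUnit_pivot hσ hx (hpivot (σ j))
  rw [hσ.involutive] at hunit
  simp only [gramSchmidt_apply, val_sub_left, val_sum_left, val_smul_left]
  rw [Finset.sum_eq_single (σ j) (fun l _ => hterm l) (by simp), gramSchmidtCoeff, Matrix.of_apply,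
    if_pos ⟨hi, hT j hj⟩, hσ.involutive, mul_assoc, Ring.inverse_mul_cancel _ hunit, mul_one,
    sub_self]

theorem val_gramSchmidt_eq_zero_of_orthogonal (hσ : IsPairing a σ)
    (hx : ∀ i, IsPure (a i) (x i q)) (hT : ∀ i ∈ T, σ i ∈ T) {i : ι} (hi : i ∉ T)
    (horth : ∀ j ≠ σ i, g.val q (x i q) (x j q) = 0) {j : ι} (hj : j ≠ σ i) :
    g.val q (g.gramSchmidt σ T x j q) (g.gramSchmidt σ T x i q) = 0 := by
  have hcomm : ∀ k ≠ σ i, g.val q (x k q) (x i q) = 0 := fun k hk =>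
    (g.val_eq_zero_comm (hx i) (hx k)).1 (horth k hk)
  have hself : g.gramSchmidt σ T x i q = x i q := g.gramSchmidt_eq_self fun l => by
    simp only [gramSchmidtCoeff, Matrix.of_apply]
    split_ifs with h
    · rw [horth (σ l) (hσ.involutive.injective.ne (by grind)), zero_mul]
    · rfl
  have hterm : ∀ l, g.gramSchmidtCoeff σ T x q j l * g.val q (x l q) (x i q) = 0 := fun l => by
    by_cases hl : l ∈ T
    · rw [hcomm l fun h => hi (by simpa [h, hσ.involutive i] using hT l hl), mul_zero]
    · simp [gramSchmidtCoeff, hl]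
  simp only [hself, g.gramSchmidt_apply j, val_sub_left, val_sum_left, val_smul_left]
  rw [hcomm j hj, Finset.sum_eq_zero fun l _ => hterm l, sub_zero]

theorem val_gramSchmidt_insert_eq_zero (hσ : IsPairing a σ) (hU : IsOpen U)
    (hx : IsPureFrameOn a x U) (hpivot : ∀ q ∈ U, ∀ i, g.bodyGram q x i (σ i) ≠ 0) (hq : q ∈ U)
    {S : Finset ι} (horth : ∀ i ∈ S, ∀ j ≠ σ i, g.val q (x i q) (x j q) = 0) {k i j : ι}
    (hi : i ∈ insert k S) (hj : j ≠ σ i) :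
    g.val q (g.gramSchmidt σ {k, σ k} x i q) (g.gramSchmidt σ {k, σ k} x j q) = 0 := by
  have hpure := fun l => (hx.isPureFieldOn l).isPure q hq
  have hpure' := fun l =>
    ((g.isPureFrameOn_gramSchmidt (T := {k, σ k}) hσ hU hx hpivot).isPureFieldOn l).isPure q hq
  have hσT : ∀ l ∈ ({k, σ k} : Finset ι), σ l ∈ ({k, σ k} : Finset ι) := by
    simp [hσ.involutive k]
  have hT : ∀ l ∈ ({k, σ k} : Finset ι), ∀ l' ∈ ({k, σ k} : Finset ι), l' ≠ σ l →
      g.val q (x l q) (x l' q) = 0 := by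
    intro l hl l' hl' hne
    have heq : l' = l := by grind [hσ.involutive k]
    subst heq
    exact g.val_self_eq_zero_of_odd (hσ.odd_of_ne l' hne.symm ▸ hpure l')
  by_cases hiT : i ∈ ({k, σ k} : Finset ι)
  · by_cases hjT : j ∈ ({k, σ k} : Finset ι)
    · rw [g.gramSchmidt_of_mem hiT, g.gramSchmidt_of_mem hjT, hT i hiT j hjT hj]
    · rw [g.val_eq_zero_comm (hpure' i) (hpure' j), g.gramSchmidt_of_mem hiT]
      exact g.val_gramSchmidt_eq_zero hσ hpure (hpivot q hq) hσT hT hjT hiT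
  · rw [g.val_eq_zero_comm (hpure' i) (hpure' j)]
    exact g.val_gramSchmidt_eq_zero_of_orthogonal hσ hpure hσT hiT (horth i (by grind)) hj

end GramSchmidtStep

/-- `w` is a frame over `U` whose Gram matrix has exactly the nonzero entries that the pattern `σ`
prescribes, these being invertible. -/
structure IsOrthogonalFrameOn (a : ι → ZMod 2) (σ : ι → ι) (w : ι → ∀ q : M, SuperTangent m n q)
    (U : Set M) : Prop where
  isPureFrameOn : IsPureFrameOn a w U
  bodyGram_ne_zero : ∀ q ∈ U, ∀ i, g.bodyGram q w i (σ i) ≠ 0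
  val_eq_zero : ∀ q ∈ U, ∀ i, ∀ j ≠ σ i, g.val q (w i q) (w j q) = 0

theorem exists_isOrthogonalFrameOn [Finite ι] (hσ : IsPairing a σ) (hU : IsOpen U) (hp : p ∈ U)
    (hx : IsPureFrameOn a x U) (hpattern : ∀ i j, g.bodyGram p x i j ≠ 0 ↔ j = σ i) :
    ∃ V : Set M, IsOpen V ∧ p ∈ V ∧ ∃ w, g.IsOrthogonalFrameOn a σ w V := by
  have := Fintype.ofFinite ι
  classical
  suffices ∀ S : Finset ι, ∃ V : Set M, IsOpen V ∧ p ∈ V ∧ ∃ w : ι → ∀ q : M, SuperTangent m n q,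
      IsPureFrameOn a w V ∧ g.bodyGram p w = g.bodyGram p x ∧
      (∀ q ∈ V, ∀ i, g.bodyGram q w i (σ i) ≠ 0) ∧
      ∀ q ∈ V, ∀ i ∈ S, ∀ j ≠ σ i, g.val q (w i q) (w j q) = 0 by
    obtain ⟨V, hV, hpV, w, hw, -, hpivot, horth⟩ := this Finset.univ
    exact ⟨V, hV, hpV, w, hw, hpivot, fun q hq i => horth q hq i (Finset.mem_univ i)⟩
  have hpivot_p : ∀ {w : ι → ∀ q : M, SuperTangent m n q}, g.bodyGram p w = g.bodyGram p x →
      ∀ i, g.bodyGram p w i (σ i) ≠ 0 := fun hw i => by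
    rw [hw]
    exact (hpattern i (σ i)).2 rfl
  intro S
  induction S using Finset.induction_on with
  | empty =>
    obtain ⟨V, hVU, hV, hpV, hpivot⟩ := g.exists_isOpen_bodyGram_ne_zero hσ hU hp hx (hpivot_p rfl)
    exact ⟨V, hV, hpV, x, hx.mono hVU, rfl, hpivot, by simp⟩
  | insert k S _ ih =>
    obtain ⟨V, hV, hpV, w, hw, hbody, hpivot, horth⟩ := ih
    have hw' := g.isPureFrameOn_gramSchmidt (T := {k, σ k}) hσ hV hw hpivot
    have hbody' : g.bodyGram p (g.gramSchmidt σ {k, σ k} w) = g.bodyGram p x := by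
      rw [g.bodyGram_gramSchmidt hσ (fun i => (hw.isPureFieldOn i).isPure p hpV), hbody]
      exact fun i j hj => by rw [hbody]; exact not_not.1 (mt (hpattern i j).1 hj)
    obtain ⟨W, hWV, hW, hpW, hpivot'⟩ :=
      g.exists_isOpen_bodyGram_ne_zero hσ hV hpV hw' (hpivot_p hbody')
    exact ⟨W, hW, hpW, _, hw'.mono hWV, hbody', hpivot', fun q hq i hi j hj =>
      g.val_gramSchmidt_insert_eq_zero hσ hV hw hpivot (hWV hq) (horth q (hWV hq)) hi hj⟩

end SuperRiemannianMetric

end GramSchmidt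

section NormalForm

variable {m n : ℕ} {M : Type*} [TopologicalSpace M] [ChartedSpace (SuperSpace m n) M]

theorem isPairing_sumMap_blockPartner (hn : Even n) :
    IsPairing (parity (m := m)) (Sum.map id (blockPartner hn)) where
  involutive k := by
    cases k <;> simp [blockPartner_involutive hn _]
  parity_apply k := by cases k <;> rfl
  odd_of_ne k hk := by
    cases k
    · exact absurd rfl hk
    · rfl

namespace SuperRiemannianMetric

variable (g : SuperRiemannianMetric m n M) {w : Fin m ⊕ Fin n → ∀ q : M, SuperTangent m n q}
  {U : Set M} {q : M} (hn : Even n)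

/-- The factors that turn the odd block of the Gram matrix into the standard one. -/
def blockScale (w : Fin m ⊕ Fin n → ∀ q : M, SuperTangent m n q) :
    Fin m ⊕ Fin n → M → SuperNumber
  | .inl _, _ => 1
  | .inr i, q => if Even (i : ℕ) then 1 else
      -Ring.inverse (g.val q (w (.inr i) q) (w (.inr (blockPartner hn i)) q))

variable {hn}

theorem blockScale_inr (i : Fin n) : g.blockScale hn w (.inr i) = fun q =>
    if Even (i : ℕ) then 1 else
      -Ring.inverse (g.val q (w (.inr i) q) (w (.inr (blockPartner hn i)) q)) := rfl

theorem isPureFunOn_blockScale (hU : IsOpen U)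
    (hw : g.IsOrthogonalFrameOn parity (Sum.map id (blockPartner hn)) w U) (k : Fin m ⊕ Fin n) :
    IsPureFunOn m n 0 (g.blockScale hn w k) U := by
  cases k with
  | inl i => exact .const one_mem_part U
  | inr i =>
    simp only [blockScale_inr]
    split_ifs
    · exact .const one_mem_part U
    · exact ((g.isPureFunOn_pivot (isPairing_sumMap_blockPartner hn) hU hw.isPureFrameOn
        (.inr i)).ringInverse fun q hq => hw.bodyGram_ne_zero q hq (.inr i)).neg

theorem isUnit_val_blockPartner
    (hw : g.IsOrthogonalFrameOn parity (Sum.map id (blockPartner hn)) w U) (hq : q ∈ U)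
    (i : Fin n) : IsUnit (g.val q (w (.inr i) q) (w (.inr (blockPartner hn i)) q)) :=
  g.isUnit_pivot (isPairing_sumMap_blockPartner hn)
    (fun k => (hw.isPureFrameOn.isPureFieldOn k).isPure q hq) (hw.bodyGram_ne_zero q hq (.inr i))

theorem isUnit_blockScale
    (hw : g.IsOrthogonalFrameOn parity (Sum.map id (blockPartner hn)) w U) (hq : q ∈ U)
    (k : Fin m ⊕ Fin n) : IsUnit (g.blockScale hn w k q) := by
  cases k with
  | inl i => exact isUnit_one
  | inr i =>
    simp only [blockScale_inr]
    split_ifs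
    · exact isUnit_one
    · exact (isUnit_ringInverse.2 (g.isUnit_val_blockPartner hw hq i)).neg

variable (hn) in
/-- The rescaling of a frame by the factors `blockScale`. -/
def blockNormalize (w : Fin m ⊕ Fin n → ∀ q : M, SuperTangent m n q) (k : Fin m ⊕ Fin n) (q : M) :
    SuperTangent m n q :=
  g.blockScale hn w k q • w k q

theorem isPureFrameOn_blockNormalize (hU : IsOpen U)
    (hw : g.IsOrthogonalFrameOn parity (Sum.map id (blockPartner hn)) w U) :
    IsPureFrameOn parity (g.blockNormalize hn w) U :=
  hw.isPureFrameOn.smul (g.isPureFunOn_blockScale hU hw) fun _ hq => g.isUnit_blockScale hw hq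

theorem val_blockNormalize_eq_zero (hU : IsOpen U)
    (hw : g.IsOrthogonalFrameOn parity (Sum.map id (blockPartner hn)) w U) (hq : q ∈ U)
    {k l : Fin m ⊕ Fin n} (hl : l ≠ Sum.map id (blockPartner hn) k) :
    g.val q (g.blockNormalize hn w k q) (g.blockNormalize hn w l q) = 0 := by
  have hpure := fun k => (hw.isPureFrameOn.isPureFieldOn k).isPure q hq
  rw [blockNormalize, blockNormalize, val_smul_left,
    g.val_smul_right (hpure k) (hpure l) ((g.isPureFunOn_blockScale hU hw l).mem_part q hq),
    hw.val_eq_zero q hq k l hl, mul_zero, smul_zero, mul_zero]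

theorem blockNormalize_inl (i : Fin m) : g.blockNormalize hn w (.inl i) q = w (.inl i) q :=
  one_smul _ _

theorem blockNormalize_inr_of_even {i : Fin n} (hi : Even (i : ℕ)) :
    g.blockNormalize hn w (.inr i) q = w (.inr i) q := by
  simp only [blockNormalize, blockScale_inr, if_pos hi, one_smul]

theorem val_blockNormalize_blockPartner (hU : IsOpen U)
    (hw : g.IsOrthogonalFrameOn parity (Sum.map id (blockPartner hn)) w U) (hq : q ∈ U)
    (i : Fin n) :
    g.val q (g.blockNormalize hn w (.inr i) q)
      (g.blockNormalize hn w (.inr (blockPartner hn i)) q) = if Even (i : ℕ) then 1 else -1 := by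
  have hodd : ∀ i : Fin n, ¬Even (i : ℕ) → g.val q (g.blockNormalize hn w (.inr i) q)
      (g.blockNormalize hn w (.inr (blockPartner hn i)) q) = -1 := fun i hi => by
    rw [g.blockNormalize_inr_of_even ((even_blockPartner_iff hn i).2 hi)]
    simp only [blockNormalize, blockScale_inr, if_neg hi, val_smul_left, neg_mul,
      Ring.inverse_mul_cancel _ (g.isUnit_val_blockPartner hw hq i)]
  split_ifs with hi
  · have hpure := fun k => ((g.isPureFrameOn_blockNormalize hU hw).isPureFieldOn k).isPure q hq
    have hpartner := hodd (blockPartner hn i) ((even_blockPartner_iff hn i).not.2 (not_not.2 hi))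
    rw [blockPartner_involutive hn i] at hpartner
    rw [g.symm q _ _ _ _ (hpure _) (hpure _), hpartner]
    simp [parity]
  · exact hodd i hi

theorem matrix_val_blockNormalize (hU : IsOpen U)
    (hw : g.IsOrthogonalFrameOn parity (Sum.map id (blockPartner hn)) w U) (hq : q ∈ U) :
    Matrix.of (fun k l => g.val q (g.blockNormalize hn w k q) (g.blockNormalize hn w l q)) =
      Matrix.fromBlocks (Matrix.diagonal fun i => g.val q (w (.inl i) q) (w (.inl i) q)) 0 0
        (blockJ n) := by
  have horth : ∀ k l, l ≠ Sum.map id (blockPartner hn) k →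
      g.val q (g.blockNormalize hn w k q) (g.blockNormalize hn w l q) = 0 :=
    fun _ _ => g.val_blockNormalize_eq_zero hU hw hq
  refine Matrix.ext ?_
  rintro (i | i) (j | j)
  · obtain rfl | hij := eq_or_ne i j
    · simp [blockNormalize_inl]
    · simpa [hij] using horth (.inl i) (.inl j) (by simpa using hij.symm)
  · exact horth (.inl i) (.inr j) (by simp)
  · exact horth (.inr i) (.inl j) (by simp)
  · simp only [Matrix.of_apply, Matrix.fromBlocks_apply₂₂, blockJ_apply hn]
    by_cases hj : j = blockPartner hn i
    · rw [if_pos hj, hj, g.val_blockNormalize_blockPartner hU hw hq]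
    · rw [if_neg hj, horth (.inr i) (.inr j) (by simpa using hj)]

theorem exists_isOrthogonalFrameOn_blockPartner [IsSuperManifold m n M] (p : M) :
    ∃ hn : Even n, ∃ U : Set M, IsOpen U ∧ p ∈ U ∧
      ∃ w : Fin m ⊕ Fin n → ∀ q : M, SuperTangent m n q,
        g.IsOrthogonalFrameOn parity (Sum.map id (blockPartner hn)) w U := by
  obtain ⟨hn, U, hU, hp, x, hx, hpattern⟩ := g.exists_frame_bodyGram_ne_zero_iff p
  exact ⟨hn, g.exists_isOrthogonalFrameOn (isPairing_sumMap_blockPartner hn) hU hp hx hpattern⟩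

end SuperRiemannianMetric

end NormalForm

end

end SuperGeometry

theorem mainTheorem3 (m n : ℕ) (M : Type*) [TopologicalSpace M]
    [ChartedSpace (SuperGeometry.SuperSpace m n) M] [SuperGeometry.IsSuperManifold m n M]
    (g : SuperGeometry.SuperRiemannianMetric m n M) (p : M) :
    Even n ∧
    ∃ (U : Set M) (E : Fin m ⊕ Fin n → ∀ q : M, SuperGeometry.SuperTangent m n q)
      (d : Fin m → M → SuperGeometry.SuperNumber),
      IsOpen U ∧ p ∈ U ∧
      (∀ k, SuperGeometry.IsVectorFieldOn (E k) U) ∧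
      (∀ i, SuperGeometry.IsGInftyOn m n (d i) U) ∧
      ∀ q ∈ U,
        (∀ k, SuperGeometry.IsPure (SuperGeometry.parity k) (E k q)) ∧
        LinearIndependent SuperGeometry.SuperNumber (fun k => E k q) ∧
        Submodule.span SuperGeometry.SuperNumber (Set.range fun k => E k q) = ⊤ ∧
        (∀ i, d i q ∈ SuperGeometry.SuperNumber.part 0 ∧
          ∃ c ∈ SuperGeometry.SuperNumber.part 0, d i q * c = 1 ∧ c * d i q = 1) ∧
        Matrix.of (fun k l => g.val q (E k q) (E l q)) =
          Matrix.fromBlocks (Matrix.diagonal fun i => d i q) 0 0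
            (SuperGeometry.blockJ n) := by
  obtain ⟨hn, U, hU, hp, w, hw⟩ := g.exists_isOrthogonalFrameOn_blockPartner p
  have hE := g.isPureFrameOn_blockNormalize hU hw
  have hd : ∀ i, SuperGeometry.IsPureFunOn m n 0
      (fun q => g.val q (w (.inl i) q) (w (.inl i) q)) U := fun i =>
    g.isPureFunOn_pivot (SuperGeometry.isPairing_sumMap_blockPartner hn) hU hw.isPureFrameOn
      (.inl i)
  refine ⟨hn, U, _, _, hU, hp, fun k => (hE.isPureFieldOn k).isVectorFieldOn,
    fun i => (hd i).smooth, fun q hq => ⟨fun k => (hE.isPureFieldOn k).isPure q hq,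
      hE.linearIndependent q hq, hE.span_eq_top q hq, fun i => ?_,
      g.matrix_val_blockNormalize hU hw hq⟩⟩
  have hbody := hw.bodyGram_ne_zero q hq (.inl i)
  have hunit := SuperGeometry.SuperNumber.isUnit_of_mem_part_zero ((hd i).mem_part q hq) hbody
  exact ⟨(hd i).mem_part q hq, _,
    SuperGeometry.SuperNumber.ringInverse_mem_part_zero ((hd i).mem_part q hq) hbody,
    Ring.mul_inverse_cancel _ hunit, Ring.inverse_mul_cancel _ hunit⟩
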